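/- For $\gamma,\delta\in\mathbb{C}$ with $\gamma\neq 0$ let $F_{\gamma,\delta}(z)=\dfrac{\gamma z}{z^2+\delta z+1}$, and for $T\in\mathbb{C}$ let $G_T(z)=z+T+\dfrac1z$; both are quadratic rational maps of the Riemann sphere $\widehat{\mathbb{C}}$ with critical points $\pm1$. The point $0$ is fixed by $F_{\gamma,\delta}$ with eigenvalue $\gamma$. Write $\langle\zeta\rangle$ for the cycle of a periodic point $\zeta$; the eigenvalue of a cycle of period $n$ of $g$ is the derivative of $g^n$ at any of its points. A cycle is parabolic if its eigenvalue is a primitive $r$-th root of unity for some $r\ge1$ and the $r$-th iterate of the return map $g^n$ is not the identity. Let $F_k=F_{\gamma_k,\delta_k}$, where $\gamma_k\to\infty$, with fixed points $a_k,b_k,0$ (listed with multiplicity) of eigenvalues $\alpha_k,\beta_k,\gamma_k$. Assume that $\alpha_k\to\omega$, where $\omega\ne1$ is a primitive $q$-th root of unity (hence $\beta_k\to\bar\omega$). Assume further that $F_k^{q}\to G_T$ locally uniformly on $\mathbb{C}\setminus\{0\}$ for some $T\in\mathbb{C}$, and let $\langle z_k\rangle$ be cycles of $F_k$ of period $n>1$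 (independent of $k$) which converge, as subsets of $\widehat{\mathbb{C}}$ in the Hausdorff sense, to a set $\mathcal{Z}\subset\widehat{\mathbb{C}}$, with eigenvalues $\rho_k\to\rho_\infty\in\mathbb{C}$. Then $G_T(\mathcal{Z})\subseteq\mathcal{Z}$. Furthermore: - If $\mathcal{Z}=\{\infty\}$, then $T=0$. - If $0\in\mathcal{Z}$, then $G_T^{m}(\chi)=0$, whence $G_T^{m+1}(\chi)=\infty=G_T^{m+2}(\chi)$, for some $\chi\in\{+1,-1\}$ and some integer $m$ with $1\le m<\frac nq$. - Otherwise (that is, if $\mathcal{Z}\neq\{\infty\}$ and $0\notin\mathcal{Z}$), $q$ divides $n$ and $\mathcal{Z}=\langle\zeta\rangle\cup\{\infty\}$, where $\langle\zeta\rangle\subset\mathbb{C}$ is a cycle of $G_T$ which either has period $\frac nq$ and eigenvalue $\rho_\infty$, or is a parabolic cycle of period less than $\frac nq$, the latter only if $\rho_\infty=1$. -/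

import Mathlib

open Filter Topology
open scoped OnePoint

namespace QuadraticLimit

/-- The Riemann sphere `Ĉ = ℂ ∪ {∞}`, with the topology of the one-point compactification. -/
abbrev Sphere : Type := OnePoint ℂ

/-- The quadratic rational map `F_{γ,δ}(z) = γ z / (z² + δ z + 1)` of the Riemann sphere
(for `γ ≠ 0`); it has critical points `±1`, and it sends `∞` to the fixed point `0`. -/
noncomputable def mapF (γ δ : ℂ) : Sphere → Sphere :=
  fun x => x.elim ((0 : ℂ) : Sphere) fun z : ℂ =>
    if z ^ 2 + δ * z + 1 = 0 then ∞ else ((γ * z / (z ^ 2 + δ * z + 1) : ℂ) : Sphere)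

/-- The quadratic rational map `G_T(z) = z + T + 1/z` of the Riemann sphere. -/
noncomputable def mapG (T : ℂ) : Sphere → Sphere :=
  fun x => x.elim ∞ fun z : ℂ => if z = 0 then ∞ else ((z + T + 1 / z : ℂ) : Sphere)

/-- The inversion `z ↦ 1/z` of the Riemann sphere, which is the change of coordinate
near `∞`. -/
noncomputable def sphereInv : Sphere → Sphere :=
  fun x => x.elim ((0 : ℂ) : Sphere) fun z : ℂ => if z = 0 then ∞ else ((z⁻¹ : ℂ) : Sphere)

/-- The affine coordinate of a finite point of the sphere (with the value `0` at `∞`). -/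
noncomputable def affine : Sphere → ℂ :=
  fun x => x.elim 0 id

/-- The eigenvalue (multiplier) of `g` at a point `ζ` with `g^n(ζ) = ζ`: the derivative of the
`n`-th iterate at `ζ`, computed in the coordinate `z` if `ζ` is finite and in the coordinate
`1/z` if `ζ = ∞`.  As `g^n(ζ) = ζ`, a continuous `g^n` takes values in the same coordinate domain
near `ζ`, so that the value of `affine` at `∞` does not matter. -/
noncomputable def eigenvalue (g : Sphere → Sphere) (n : ℕ) : Sphere → ℂ :=
  fun x => x.elim
    (deriv (fun w : ℂ => affine (sphereInv (g^[n] (sphereInv (w : Sphere))))) 0)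
    fun ζ : ℂ => deriv (fun w : ℂ => affine (g^[n] (w : Sphere))) ζ

/-- The forward orbit `{z, g(z), g²(z), …}` of `z`; this is the cycle `⟨z⟩` when `z` is
periodic. -/
def orbit (g : Sphere → Sphere) (z : Sphere) : Set Sphere :=
  Set.range fun j : ℕ => g^[j] z

/-- The point `ζ` is periodic of period `m` under `g` and its cycle is parabolic: the eigenvalue of
the cycle is a primitive `r`-th root of unity for some `r ≥ 1`, and the `r`-th iterate of the
return map `g^m` is not the identity. -/
def IsParabolic (g : Sphere → Sphere) (m : ℕ) (ζ : Sphere) : Prop :=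
  0 < m ∧ Function.minimalPeriod g ζ = m ∧
    ∃ r : ℕ, 0 < r ∧ IsPrimitiveRoot (eigenvalue g m ζ) r ∧ g^[m * r] ≠ id

/-- `Fix(F_{γ,δ}) = [a, b, 0]`, with multiplicity: the roots of the fixed point equation
`z (z² + δ z + 1) = γ z` are `a`, `b` and `0`. -/
def FixedPointsMarked (γ δ a b : ℂ) : Prop :=
  ∀ z : ℂ, z * (z ^ 2 + δ * z + 1) - γ * z = (z - a) * (z - b) * (z - 0)

/-- Locally uniform convergence on `S ⊆ Ĉ` of a sequence of self-maps of the sphere, with respect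
to the unique uniform structure of the compact Hausdorff space `Ĉ`
(that of the spherical metric). -/
def TendsToLocallyUniformlyOn (f : ℕ → Sphere → Sphere) (g : Sphere → Sphere)
    (S : Set Sphere) : Prop :=
  @TendstoLocallyUniformlyOn Sphere Sphere ℕ _ uniformSpaceOfCompactR1 f g atTop S

/-- Convergence `C_k → Z` of subsets of the sphere (Hausdorff convergence, in the Vietoris form):
every neighbourhood of every point of `Z` meets `C_k` for all large `k`, and every open set
that contains `Z` contains `C_k` for all large `k`. -/
def SetsTendTo (C : ℕ → Set Sphere) (Z : Set Sphere) : Prop :=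
  (∀ ζ ∈ Z, ∀ U ∈ 𝓝 ζ, ∀ᶠ k in atTop, (C k ∩ U).Nonempty) ∧
    ∀ U : Set Sphere, IsOpen U → Z ⊆ U → ∀ᶠ k in atTop, C k ⊆ U

end QuadraticLimit

open QuadraticLimit

/-!
The proof rests on one identity.  Let `a`, `b` be the nonzero fixed points of `F = F_{γ,δ}`, so that
`a + b = -δ` and `a b = 1 - γ`.  In the coordinate `u(z) = (z - a) / (z - b)` the map becomes
`u(F z) = u(z) (a z - 1) / (b z - 1)` (`cross_map`), and
`(a z - 1) / (b z - 1) = (a / b) (1 + ε / (z - 1 / b))` with `ε = 1 / b - 1 / a`.  As `γ → ∞`,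
both `a` and `b` tend to `∞` and `a / b → ω`, so `F` is close to the rotation `u ↦ ω u` as long as `z`
stays away from `0`.  Three facts follow.
* An orbit that starts near a point of `ℂ \ {0}` has `u` close to `ω`, and it stays near `∞` at
  the times which are not multiples of `q` (`Degenerating.escape`); at the times `q, 2 q, …` it
  follows `G_T`, as long as the orbit under `G_T` avoids `0`.
* The translation `T` is the limit of `((a / b) ^ q - 1) / ε` (`IterateTendsto.drift`).
* Along an `n`-cycle the factors `(a z - 1) / (b z - 1)` multiply to `1`.  If the whole cycle tends to
  `∞`, this gives `(a / b) ^ n = 1 + o(ε)`, so that `q ∣ n` and `T = 0`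
  (`Degenerating.drift_of_escaping_cycle`).

All limits are taken along an ultrafilter, so that each point of the cycle has a limit `L i` in the
sphere; the Hausdorff limit is then the finite set of these points (`SetsTendTo.eq_image`).

If `0` is a limit point, compare the derivative of `F` in the metric `|dz| / (|γ| + |z|²)`: it is
bounded below away from `±1` and tends to infinity near `0` (`one_le_metric_derivative_mul`).  Since the
multiplier stays bounded, some limit point is a critical point `χ = ±1`, and its `G_T`-orbit has to
run into `0`, as otherwise the cycle would follow this orbit forever and stay away from `0`
(`LimitCycle.critical_orbit`).

Otherwise a finite limit point `ζ` has a `G_T`-orbit in `ℂ \ {0}`, which the cycle follows; hence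
`n = m q` and `G_T^m ζ = ζ`, and the multiplier converges since `F^n → G_T^m` holomorphically near
`ζ`.  If the period of `ζ` is a proper divisor of `m`, two different fixed points of `F^n` converge to
`ζ`; this is impossible unless `G_T^m` has derivative `1` at `ζ` (`eventually_eq_of_fixed`), and
then the multiplier of the shorter cycle is a root of unity (`LimitCycle.multiplier_dichotomy`).
-/

namespace QuadraticLimit

/-! ### The cross-ratio coordinate -/

/-- The first `N` steps of an orbit of `F_{γ,δ}` which stays in `ℂ \ {0}`, written in the affine
coordinate. -/
def IsAffineOrbit (γ δ : ℂ) (N : ℕ) (x : ℕ → ℂ) : Prop :=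
  (∀ i < N, x i ^ 2 + δ * x i + 1 ≠ 0 ∧ x (i + 1) = γ * x i / (x i ^ 2 + δ * x i + 1)) ∧
    ∀ i ≤ N, x i ≠ 0

/-- The coordinate `u(z) = (z - a) / (z - b)` turns `F_{γ,δ}` into multiplication by
`(a z - 1) / (b z - 1)`. -/
lemma cross_map {γ δ a b x : ℂ} (hs : a + b = -δ) (hp : a * b = 1 - γ)
    (hD : x ^ 2 + δ * x + 1 ≠ 0) :
    (γ * x / (x ^ 2 + δ * x + 1) - a) / (γ * x / (x ^ 2 + δ * x + 1) - b) =
      (x - a) / (x - b) * ((a * x - 1) / (b * x - 1)) := by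
  obtain rfl : δ = -(a + b) := by rw [hs]; ring
  obtain rfl : γ = 1 - a * b := by rw [hp]; ring
  have h1 : (1 - a * b) * x / (x ^ 2 + -(a + b) * x + 1) - a =
      -((x - a) * (a * x - 1)) / (x ^ 2 + -(a + b) * x + 1) := by
    rw [div_sub' hD]; ring
  have h2 : (1 - a * b) * x / (x ^ 2 + -(a + b) * x + 1) - b =
      -((x - b) * (b * x - 1)) / (x ^ 2 + -(a + b) * x + 1) := by
    rw [div_sub' hD]; ring
  rw [h1, h2, div_div_div_cancel_right₀ hD, neg_div_neg_eq, mul_div_mul_comm]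

lemma cross_orbit {γ δ a b : ℂ} (hs : a + b = -δ) (hp : a * b = 1 - γ) {N : ℕ} {x : ℕ → ℂ}
    (hx : IsAffineOrbit γ δ N x) {i : ℕ} (hi : i ≤ N) :
    (x i - a) / (x i - b) =
      (x 0 - a) / (x 0 - b) * ∏ j ∈ Finset.range i, (a * x j - 1) / (b * x j - 1) := by
  induction i with
  | zero => simp
  | succ i ih =>
    have h := hx.1 i (by omega)
    rw [h.2, cross_map hs hp h.1, ih (by omega), Finset.prod_range_succ, mul_assoc]

/-! ### Asymptotics of the fixed points -/

/-- The asymptotic regime: along the filter `l` the multiplier `γ` at `0` tends to `∞`, and the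
multiplier `(1 - a ^ 2) / γ` at the fixed point `a` tends to `ω`.  The equations for `a + b` and
`a * b` say that `a`, `b` are the nonzero fixed points. -/
structure Degenerating (l : Filter ℕ) (γ δ a b : ℕ → ℂ) (ω : ℂ) : Prop where
  ne_zero : ∀ k, γ k ≠ 0
  sum : ∀ k, a k + b k = -δ k
  prod : ∀ k, a k * b k = 1 - γ k
  inv_gamma : Tendsto (fun k => (γ k)⁻¹) l (𝓝 0)
  mult : Tendsto (fun k => (1 - a k ^ 2) / γ k) l (𝓝 ω)
  omega_ne_zero : ω ≠ 0

namespace Degenerating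

variable {l : Filter ℕ} {γ δ a b : ℕ → ℂ} {ω : ℂ}

lemma mono {l' : Filter ℕ} (h : Degenerating l γ δ a b ω) (hl : l' ≤ l) :
    Degenerating l' γ δ a b ω :=
  ⟨h.ne_zero, h.sum, h.prod, h.inv_gamma.mono_left hl, h.mult.mono_left hl, h.omega_ne_zero⟩

lemma sq_div (h : Degenerating l γ δ a b ω) :
    Tendsto (fun k => a k ^ 2 / γ k) l (𝓝 (-ω)) := by
  have := h.inv_gamma.sub h.mult
  rw [zero_sub] at this
  refine this.congr fun k => ?_
  have := h.ne_zero k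
  field_simp; ring

lemma prod_div (h : Degenerating l γ δ a b ω) :
    Tendsto (fun k => a k * b k / γ k) l (𝓝 (-1)) := by
  have := h.inv_gamma.sub_const 1
  rw [zero_sub] at this
  refine this.congr fun k => ?_
  have := h.ne_zero k
  rw [h.prod]
  field_simp

lemma ratio (h : Degenerating l γ δ a b ω) : Tendsto (fun k => a k / b k) l (𝓝 ω) := by
  have := h.sq_div.div h.prod_div (by simp)
  rw [neg_div_neg_eq, div_one] at this
  refine this.congr fun k => ?_
  rw [Pi.div_apply, div_div_div_cancel_right₀ (h.ne_zero k), sq]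
  by_cases ha : a k = 0
  · simp [ha]
  · exact mul_div_mul_left _ _ ha

lemma inv_a (h : Degenerating l γ δ a b ω) : Tendsto (fun k => (a k)⁻¹) l (𝓝 0) := by
  have h1 := h.inv_gamma.div h.sq_div (neg_ne_zero.2 h.omega_ne_zero)
  rw [zero_div] at h1
  have h2 := (Real.continuous_sqrt.tendsto _).comp h1.norm
  rw [norm_zero, Real.sqrt_zero] at h2
  refine tendsto_zero_iff_norm_tendsto_zero.2 (h2.congr fun k => ?_)
  have := h.ne_zero k
  have h3 : (γ k)⁻¹ / (a k ^ 2 / γ k) = (a k)⁻¹ ^ 2 := by field_simp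
  rw [Function.comp_apply, Pi.div_apply, h3, norm_pow, Real.sqrt_sq (norm_nonneg _)]

lemma a_ne_zero (h : Degenerating l γ δ a b ω) : ∀ᶠ k in l, a k ≠ 0 := by
  filter_upwards [h.ratio.eventually_ne h.omega_ne_zero] with k hk h0
  simp [h0] at hk

lemma b_ne_zero (h : Degenerating l γ δ a b ω) : ∀ᶠ k in l, b k ≠ 0 := by
  filter_upwards [h.ratio.eventually_ne h.omega_ne_zero] with k hk h0
  simp [h0] at hk

lemma inv_b (h : Degenerating l γ δ a b ω) : Tendsto (fun k => (b k)⁻¹) l (𝓝 0) := by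
  have := h.inv_a.mul h.ratio
  rw [zero_mul] at this
  refine this.congr' ?_
  filter_upwards [h.a_ne_zero] with k hk
  field_simp

lemma a_ne_b (h : Degenerating l γ δ a b ω) (hω : ω ≠ 1) : ∀ᶠ k in l, a k ≠ b k := by
  filter_upwards [h.ratio.eventually_ne hω, h.b_ne_zero] with k hk hb h0
  exact hk (by rw [h0, div_self hb])

lemma mult_b (h : Degenerating l γ δ a b ω) :
    Tendsto (fun k => (1 - b k ^ 2) / γ k) l (𝓝 ω⁻¹) := by
  have h1 := h.inv_gamma.sub ((h.ratio.inv₀ h.omega_ne_zero).mul h.prod_div)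
  rw [mul_neg_one, zero_sub, neg_neg] at h1
  refine h1.congr' ?_
  filter_upwards [h.a_ne_zero, h.b_ne_zero] with k ha hb
  have hγ := h.ne_zero k
  field_simp

lemma delta_bound (h : Degenerating l γ δ a b ω) :
    ∃ C : ℝ, 0 ≤ C ∧ ∀ᶠ k in l, ‖δ k‖ ^ 2 ≤ C * ‖γ k‖ := by
  have h1 := (h.sq_div.add (h.prod_div.mul_const 2)).add
    ((h.ratio.inv₀ h.omega_ne_zero).mul h.prod_div)
  refine ⟨‖-ω + -1 * 2 + ω⁻¹ * -1‖ + 1, by positivity, ?_⟩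
  filter_upwards [h1.norm.eventually_le_const (lt_add_one _), h.a_ne_zero, h.b_ne_zero]
    with k hk ha hb
  have hγ := h.ne_zero k
  have h2 : a k ^ 2 / γ k + a k * b k / γ k * 2 + (a k / b k)⁻¹ * (a k * b k / γ k) =
      δ k ^ 2 / γ k := by
    have h3 : δ k = -(a k + b k) := by rw [h.sum]; ring
    rw [h3]
    field_simp; ring
  rw [h2, norm_div, norm_pow, div_le_iff₀ (norm_pos_iff.2 hγ)] at hk
  exact hk

/-! ### Transport of orbits in the cross-ratio coordinate -/

lemma inv_sub_inv (h : Degenerating l γ δ a b ω) :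
    Tendsto (fun k => (b k)⁻¹ - (a k)⁻¹) l (𝓝 0) := by
  simpa using h.inv_b.sub h.inv_a

/-- One step multiplies the cross-ratio coordinate by `a / b`, up to the relative error `ε c`, where
`ε = 1 / b - 1 / a` and `c` is the limit of the reciprocal of the point. -/
lemma factor (h : Degenerating l γ δ a b ω) {x : ℕ → ℂ} {c : ℂ}
    (hx : Tendsto (fun k => (x k)⁻¹) l (𝓝 c)) (h0 : ∀ᶠ k in l, x k ≠ 0) :
    ∃ C : ℕ → ℂ, Tendsto C l (𝓝 c) ∧ ∀ᶠ k in l, (a k * x k - 1) / (b k * x k - 1) =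
      a k / b k * (1 + ((b k)⁻¹ - (a k)⁻¹) * C k) := by
  have h1 : Tendsto (fun k => 1 - (x k)⁻¹ * (b k)⁻¹) l (𝓝 1) := by
    simpa using (hx.mul h.inv_b).const_sub 1
  refine ⟨fun k => (x k)⁻¹ / (1 - (x k)⁻¹ * (b k)⁻¹), ?_, ?_⟩
  · have := hx.div h1 one_ne_zero
    rwa [div_one] at this
  · filter_upwards [h1.eventually_ne one_ne_zero, h.a_ne_zero, h.b_ne_zero, h0]
      with k h1 ha hb hx
    have h2 : b k * x k - 1 ≠ 0 := by
      intro h3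
      apply h1
      rw [← mul_inv, mul_comm, sub_eq_zero.1 h3]
      simp
    have h4 : 1 - (x k)⁻¹ * (b k)⁻¹ = (b k * x k - 1) / (b k * x k) := by field_simp
    have h5 : ((b k)⁻¹ - (a k)⁻¹) * ((x k)⁻¹ / ((b k * x k - 1) / (b k * x k))) =
        (a k - b k) / (a k * (b k * x k - 1)) := by
      rw [_root_.inv_sub_inv hb ha]
      field_simp
    rw [h4, h5, add_div' _ _ _ (mul_ne_zero ha h2), div_mul_div_comm, div_eq_div_iff h2
      (mul_ne_zero hb (mul_ne_zero ha h2))]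
    ring

lemma factor_tendsto (h : Degenerating l γ δ a b ω) {x : ℕ → ℂ} {c : ℂ}
    (hx : Tendsto (fun k => (x k)⁻¹) l (𝓝 c)) (h0 : ∀ᶠ k in l, x k ≠ 0) :
    Tendsto (fun k => (a k * x k - 1) / (b k * x k - 1)) l (𝓝 ω) := by
  obtain ⟨C, hC, he⟩ := h.factor hx h0
  have := h.ratio.mul ((h.inv_sub_inv.mul hC).const_add 1)
  rw [zero_mul, add_zero, mul_one] at this
  exact this.congr' (he.mono fun k hk => hk.symm)

lemma prod_factor (h : Degenerating l γ δ a b ω) {x : ℕ → ℕ → ℂ} {c : ℕ → ℂ} {N : ℕ}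
    (hx : ∀ i < N, Tendsto (fun k => (x k i)⁻¹) l (𝓝 (c i)))
    (h0 : ∀ i < N, ∀ᶠ k in l, x k i ≠ 0) :
    ∃ C : ℕ → ℂ, Tendsto C l (𝓝 (∑ i ∈ Finset.range N, c i)) ∧ ∀ᶠ k in l,
      ∏ i ∈ Finset.range N, (a k * x k i - 1) / (b k * x k i - 1) =
        (a k / b k) ^ N * (1 + ((b k)⁻¹ - (a k)⁻¹) * C k) := by
  induction N with
  | zero => exact ⟨fun _ => 0, by simpa using tendsto_const_nhds, by simp⟩
  | succ N ih =>
    obtain ⟨C, hC, he⟩ := ih (fun i hi => hx i (by omega)) (fun i hi => h0 i (by omega))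
    obtain ⟨D, hD, hf⟩ := h.factor (hx N (by omega)) (h0 N (by omega))
    refine ⟨fun k => C k + D k + ((b k)⁻¹ - (a k)⁻¹) * (C k * D k), ?_, ?_⟩
    · have := (hC.add hD).add (h.inv_sub_inv.mul (hC.mul hD))
      rwa [zero_mul, add_zero, ← Finset.sum_range_succ] at this
    · filter_upwards [he, hf] with k he hf
      rw [Finset.prod_range_succ, he, hf]
      ring

/-- Points at bounded distance from `0` and `∞` have cross-ratio coordinate close to `ω`. -/
lemma cross_tendsto (h : Degenerating l γ δ a b ω) {x : ℕ → ℂ} {ζ : ℂ}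
    (hx : Tendsto x l (𝓝 ζ)) : Tendsto (fun k => (x k - a k) / (x k - b k)) l (𝓝 ω) := by
  have := h.ratio.mul (((hx.mul h.inv_a).sub_const 1).div ((hx.mul h.inv_b).sub_const 1)
    (by simp))
  simp only [mul_zero, zero_sub, ne_eq, neg_eq_zero, one_ne_zero, not_false_eq_true, div_self,
    mul_one] at this
  refine this.congr' ?_
  filter_upwards [h.a_ne_zero, h.b_ne_zero] with k ha hb
  have h1 : x k * (a k)⁻¹ - 1 = (x k - a k) / a k := by field_simp
  have h2 : x k * (b k)⁻¹ - 1 = (x k - b k) / b k := by field_simp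
  rw [Pi.div_apply, h1, h2]
  field_simp

/-- An orbit starting near `ζ ∈ ℂ \ {0}` follows the rotation `u ↦ ω u` in the cross-ratio
coordinate, and therefore it stays near `∞` until time `q`. -/
lemma escape (h : Degenerating l γ δ a b ω) {q : ℕ} (hω : IsPrimitiveRoot ω q) (hω1 : ω ≠ 1)
    {N : ℕ} {x : ℕ → ℕ → ℂ} (hx : ∀ᶠ k in l, IsAffineOrbit (γ k) (δ k) N (x k)) {ζ : ℂ}
    (hζ : ζ ≠ 0) (h0 : Tendsto (fun k => x k 0) l (𝓝 ζ)) {i : ℕ} (hiN : i ≤ N) (hi0 : 0 < i)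
    (hiq : i < q) : Tendsto (fun k => (x k i)⁻¹) l (𝓝 0) := by
  suffices H : ∀ i ≤ N, i < q →
      Tendsto (fun k => (x k i - a k) / (x k i - b k)) l (𝓝 (ω ^ (i + 1))) ∧
      Tendsto (fun k => (x k i)⁻¹) l (𝓝 (if i = 0 then ζ⁻¹ else 0)) by
    have := (H i hiN hiq).2
    rwa [if_neg hi0.ne'] at this
  intro i
  induction i with
  | zero =>
    intro _ _
    exact ⟨by simpa using h.cross_tendsto h0, by simpa using h0.inv₀ hζ⟩
  | succ i ih =>
    intro hiN hiq
    obtain ⟨h1, h2⟩ := ih (by omega) (by omega)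
    have h3 := h1.mul (h.factor_tendsto h2 (hx.mono fun k hk => hk.2 i (by omega)))
    rw [← pow_succ] at h3
    have h4 : Tendsto (fun k => (x k (i + 1) - a k) / (x k (i + 1) - b k)) l
        (𝓝 (ω ^ (i + 1 + 1))) := by
      refine h3.congr' (hx.mono fun k hk => ?_)
      have h5 := hk.1 i (by omega)
      simp only
      rw [h5.2, cross_map (h.sum k) (h.prod k) h5.1]
    refine ⟨h4, ?_⟩
    have h5 : ω ^ (i + 1 + 1) - ω ≠ 0 := by
      have h6 : ω ^ (i + 1) ≠ 1 := hω.pow_ne_one_of_pos_of_lt (by omega) hiq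
      have h7 : ω ^ (i + 1 + 1) - ω = ω * (ω ^ (i + 1) - 1) := by ring
      rw [h7]
      exact mul_ne_zero h.omega_ne_zero (sub_ne_zero.2 h6)
    have h6 := (h.inv_b.mul (h4.sub_const 1)).div (h4.sub h.ratio) h5
    rw [zero_mul, zero_div] at h6
    rw [if_neg (by omega)]
    refine h6.congr' ?_
    filter_upwards [h4.eventually_ne (pow_ne_zero _ h.omega_ne_zero), h.b_ne_zero, h.a_ne_b hω1,
      hx] with k h7 hb hab hk
    have h8 : x k (i + 1) - b k ≠ 0 := fun h9 => h7 (by rw [h9, div_zero])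
    have h9 := hk.2 (i + 1) hiN
    have h10 : b k - a k ≠ 0 := sub_ne_zero.2 hab.symm
    have h11 : (x k (i + 1) - a k) / (x k (i + 1) - b k) - 1 =
      (b k - a k) / (x k (i + 1) - b k) := by field_simp; ring
    have h12 : (x k (i + 1) - a k) / (x k (i + 1) - b k) - a k / b k =
      x k (i + 1) * (b k - a k) / (b k * (x k (i + 1) - b k)) := by field_simp; ring
    rw [Pi.div_apply, h11, h12]
    field_simp

/-- The translation length of the limit of `F^q` is read off from the multiplier `(a / b) ^ q` of the
`q`-th power of the nearly periodic Möbius transformation underlying `F`. -/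
lemma drift (h : Degenerating l γ δ a b ω) {q : ℕ} (hω : IsPrimitiveRoot ω q) (hω1 : ω ≠ 1)
    {x : ℕ → ℕ → ℂ} (hq : 0 < q) (hx : ∀ᶠ k in l, IsAffineOrbit (γ k) (δ k) q (x k)) {ζ η : ℂ}
    (hζ : ζ ≠ 0) (h0 : Tendsto (fun k => x k 0) l (𝓝 ζ)) (h1 : Tendsto (fun k => x k q) l (𝓝 η)) :
    Tendsto (fun k => ((a k / b k) ^ q - 1) / ((b k)⁻¹ - (a k)⁻¹)) l (𝓝 (η - ζ - 1 / ζ)) := by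
  obtain ⟨C, hC, he⟩ := h.prod_factor (x := x) (N := q) (c := fun i => if i = 0 then ζ⁻¹ else 0)
    (fun i hi => by
      by_cases hi0 : i = 0
      · simpa [hi0] using h0.inv₀ hζ
      · simpa [hi0] using h.escape hω hω1 hx hζ h0 hi.le (Nat.pos_of_ne_zero hi0) hi)
    (fun i hi => hx.mono fun k hk => hk.2 i hi.le)
  rw [Finset.sum_ite_eq' (Finset.range q) 0, if_pos (Finset.mem_range.2 hq)] at hC
  have hp := h.ratio.pow q
  rw [hω.pow_eq_one] at hp
  have h2 := (((h1.sub h0).div ((h1.mul h.inv_b).sub_const 1) (by simp)).div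
    ((h0.mul h.inv_a).sub_const 1) (by simp)).sub (hp.mul hC)
  have h3 : (η - ζ) / (η * 0 - 1) / (ζ * 0 - 1) - 1 * ζ⁻¹ = η - ζ - 1 / ζ := by
    rw [mul_zero, mul_zero, zero_sub]; simp [div_neg]
  rw [h3] at h2
  refine h2.congr' ?_
  filter_upwards [he, hx, h.a_ne_zero, h.b_ne_zero, h.a_ne_b hω1,
    (h.cross_tendsto h0).eventually_ne h.omega_ne_zero,
    (h.cross_tendsto h1).eventually_ne h.omega_ne_zero] with k he hk ha hb hab h4 h5
  have h6 : x k 0 - a k ≠ 0 := fun h => h4 (by rw [h, zero_div])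
  have h7 : x k 0 - b k ≠ 0 := fun h => h4 (by rw [h, div_zero])
  have h8 : x k q - b k ≠ 0 := fun h => h5 (by rw [h, div_zero])
  have h9 : (b k)⁻¹ - (a k)⁻¹ ≠ 0 := sub_ne_zero.2 fun h => hab (inv_injective h).symm
  have h10 := cross_orbit (h.sum k) (h.prod k) hk le_rfl
  rw [he] at h10
  have h11 : (x k q - a k) / (x k q - b k) * ((x k 0 - b k) / (x k 0 - a k)) =
      (a k / b k) ^ q * (1 + ((b k)⁻¹ - (a k)⁻¹) * C k) := by
    rw [h10]; field_simp
  have h12 : x k q * (b k)⁻¹ - 1 = (x k q - b k) / b k := by field_simp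
  have h13 : x k 0 * (a k)⁻¹ - 1 = (x k 0 - a k) / a k := by field_simp
  have h14 : (x k q - x k 0) / ((x k q - b k) / b k) / ((x k 0 - a k) / a k) *
      ((b k)⁻¹ - (a k)⁻¹) =
      (x k q - a k) / (x k q - b k) * ((x k 0 - b k) / (x k 0 - a k)) - 1 := by
    field_simp; ring
  simp only [Pi.div_apply]
  rw [h12, h13, eq_div_iff h9, sub_mul, h14, h11]
  ring

/-- If all points of an `n`-cycle tend to `∞`, the telescoping product of the factors over the
cycle equals `1`, and this leaves no room for a translation. -/
lemma drift_of_escaping_cycle (h : Degenerating l γ δ a b ω) [l.NeBot] {q : ℕ}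
    (hω : IsPrimitiveRoot ω q) (hω1 : ω ≠ 1) {n : ℕ} (hn : 0 < n) {x : ℕ → ℕ → ℂ}
    (hx : ∀ᶠ k in l, IsAffineOrbit (γ k) (δ k) n (x k)) (hper : ∀ᶠ k in l, x k n = x k 0)
    (ha : ∀ᶠ k in l, x k 0 ≠ a k) (hb : ∀ᶠ k in l, x k 0 ≠ b k)
    (hinf : ∀ i < n, Tendsto (fun k => (x k i)⁻¹) l (𝓝 0)) :
    Tendsto (fun k => ((a k / b k) ^ q - 1) / ((b k)⁻¹ - (a k)⁻¹)) l (𝓝 0) := by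
  obtain ⟨C, hC, he⟩ := h.prod_factor (x := x) (N := n) (c := fun _ => 0) hinf
    (fun i hi => hx.mono fun k hk => hk.2 i hi.le)
  rw [Finset.sum_const_zero] at hC
  have h1 : ∀ᶠ k in l, (a k / b k) ^ n * (1 + ((b k)⁻¹ - (a k)⁻¹) * C k) = 1 := by
    filter_upwards [he, hx, hper, ha, hb] with k he hk hper ha hb
    have h2 := cross_orbit (h.sum k) (h.prod k) hk le_rfl
    rw [hper, he] at h2
    have h3 : (x k 0 - a k) / (x k 0 - b k) ≠ 0 :=
      div_ne_zero (sub_ne_zero.2 ha) (sub_ne_zero.2 hb)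
    exact mul_left_cancel₀ h3 (by rw [← h2, mul_one])
  have h2 : Tendsto (fun k => 1 + ((b k)⁻¹ - (a k)⁻¹) * C k) l (𝓝 1) := by
    simpa using (h.inv_sub_inv.mul hC).const_add 1
  have h3 : ω ^ n = 1 := by
    have := (h.ratio.pow n).mul h2
    rw [mul_one] at this
    exact tendsto_nhds_unique this (tendsto_const_nhds.congr' (h1.mono fun k hk => hk.symm))
  obtain ⟨m, rfl⟩ := hω.dvd_of_pow_eq_one _ h3
  have hm : (m : ℂ) ≠ 0 := by
    rintro h4
    simp [Nat.cast_eq_zero.1 h4] at hn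
  have hp := h.ratio.pow q
  rw [hω.pow_eq_one] at hp
  -- `(a / b) ^ (q m) - 1` is `(a / b) ^ q - 1` times a geometric sum which tends to `m ≠ 0`.
  have hg : Tendsto (fun k => ∑ i ∈ Finset.range m, ((a k / b k) ^ q) ^ i) l (𝓝 m) := by
    have := tendsto_finsetSum (Finset.range m) fun i _ => hp.pow i
    simpa using this
  have h4 := ((hp.pow m).mul hC).neg.div hg hm
  rw [mul_zero, neg_zero, zero_div] at h4
  refine h4.congr' ?_
  filter_upwards [h1, h.a_ne_b hω1, hg.eventually_ne hm] with k h1 hab hg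
  have h9 : (b k)⁻¹ - (a k)⁻¹ ≠ 0 := sub_ne_zero.2 fun h => hab (inv_injective h).symm
  rw [Pi.div_apply, div_eq_div_iff hg h9, mul_comm _ (∑ i ∈ Finset.range m, _),
    geom_sum_mul, ← pow_mul]
  linear_combination -h1

end Degenerating

/-! ### The maps on the Riemann sphere -/

@[simp] lemma affine_coe (z : ℂ) : affine (z : Sphere) = z := rfl

lemma coe_affine {s : Sphere} (hs : s ≠ ∞) : (affine s : Sphere) = s := by
  obtain ⟨z, rfl⟩ := OnePoint.ne_infty_iff_exists.1 hs
  rfl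

@[simp] lemma coe_inj {z w : ℂ} : (z : Sphere) = (w : Sphere) ↔ z = w := OnePoint.coe_eq_coe

@[simp] lemma mapF_infty (γ δ : ℂ) : mapF γ δ ∞ = ((0 : ℂ) : Sphere) := rfl

lemma mapF_coe {γ δ z : ℂ} (hD : z ^ 2 + δ * z + 1 ≠ 0) :
    mapF γ δ (z : Sphere) = ((γ * z / (z ^ 2 + δ * z + 1) : ℂ) : Sphere) :=
  if_neg hD

lemma mapF_pole {γ δ z : ℂ} (hD : z ^ 2 + δ * z + 1 = 0) : mapF γ δ (z : Sphere) = ∞ :=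
  if_pos hD

@[simp] lemma mapF_zero (γ δ : ℂ) : mapF γ δ ((0 : ℂ) : Sphere) = ((0 : ℂ) : Sphere) := by
  rw [mapF_coe (by simp)]
  simp

@[simp] lemma mapG_infty (T : ℂ) : mapG T ∞ = ∞ := rfl

@[simp] lemma mapG_zero (T : ℂ) : mapG T ((0 : ℂ) : Sphere) = ∞ := if_pos rfl

lemma mapG_coe {T z : ℂ} (hz : z ≠ 0) : mapG T (z : Sphere) = ((z + T + 1 / z : ℂ) : Sphere) :=
  if_neg hz

lemma mapG_iterate_infty (T : ℂ) (n : ℕ) : (mapG T)^[n] ∞ = ∞ :=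
  Function.iterate_fixed (mapG_infty T) n

lemma continuousAt_affine (z : ℂ) : ContinuousAt affine (z : Sphere) :=
  OnePoint.continuousAt_coe.2 continuousAt_id

lemma tendsto_coe_iff {α : Type*} {l : Filter α} {x : α → ℂ} {ζ : ℂ} :
    Tendsto (fun k => (x k : Sphere)) l (𝓝 (ζ : Sphere)) ↔ Tendsto x l (𝓝 ζ) :=
  OnePoint.isOpenEmbedding_coe.isEmbedding.tendsto_nhds_iff.symm

lemma tendsto_inv_of_tendsto_infty {α : Type*} {l : Filter α} {x : α → ℂ}
    (h : Tendsto (fun k => (x k : Sphere)) l (𝓝 ∞)) : Tendsto (fun k => (x k)⁻¹) l (𝓝 0) := by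
  have h1 : Tendsto x l (comap ((↑) : ℂ → Sphere) (𝓝 ∞)) := tendsto_comap_iff.2 h
  rw [OnePoint.comap_coe_nhds_infty, coclosedCompact_eq_cocompact, ← Metric.cobounded_eq_cocompact]
    at h1
  exact tendsto_inv₀_cobounded.comp h1

lemma tendsto_infty_of_tendsto_inv {α : Type*} {l : Filter α} {x : α → ℂ}
    (h : Tendsto (fun k => (x k)⁻¹) l (𝓝 0)) (h0 : ∀ᶠ k in l, x k ≠ 0) :
    Tendsto (fun k => (x k : Sphere)) l (𝓝 ∞) := by
  have h1 : Tendsto (fun k => (x k)⁻¹) l (𝓝[≠] 0) :=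
    tendsto_nhdsWithin_iff.2 ⟨h, h0.mono fun k hk => inv_ne_zero hk⟩
  have h2 := tendsto_inv₀_nhdsNE_zero.comp h1
  rw [Metric.cobounded_eq_cocompact, ← coclosedCompact_eq_cocompact] at h2
  refine (OnePoint.tendsto_coe_infty.comp h2).congr fun k => ?_
  simp

lemma continuousAt_mapG {T : ℂ} {s : Sphere} (hs : s ∈ ({((0 : ℂ) : Sphere), ∞} : Set Sphere)ᶜ) :
    ContinuousAt (mapG T) s := by
  simp only [Set.mem_compl_iff, Set.mem_insert_iff, Set.mem_singleton_iff, not_or] at hs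
  obtain ⟨z, rfl⟩ := OnePoint.ne_infty_iff_exists.1 hs.2
  have hz : z ≠ 0 := fun h => hs.1 (by rw [h])
  refine OnePoint.continuousAt_coe.2 ?_
  have h1 : ContinuousAt (fun w : ℂ => ((w + T + 1 / w : ℂ) : Sphere)) z :=
    tendsto_coe_iff.2 ((continuousAt_id.add continuousAt_const).add
      (continuousAt_const.div continuousAt_id hz)).tendsto
  refine h1.congr ?_
  filter_upwards [isOpen_ne.mem_nhds hz] with w hw
  exact (mapG_coe hw).symm

/-- The set `{0, ∞}` is forward invariant, so an orbit segment that ends outside it stays outside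
it, and it is an affine orbit. -/
lemma isAffineOrbit_of_iterate {γ δ : ℂ} {N : ℕ} {s : Sphere}
    (hs : (mapF γ δ)^[N] s ∈ ({((0 : ℂ) : Sphere), ∞} : Set Sphere)ᶜ) :
    (∀ i ≤ N, (mapF γ δ)^[i] s ≠ ∞) ∧
      IsAffineOrbit γ δ N (fun i => affine ((mapF γ δ)^[i] s)) := by
  have hinv : Set.MapsTo (mapF γ δ) {((0 : ℂ) : Sphere), ∞} {((0 : ℂ) : Sphere), ∞} := by
    rintro x (rfl | rfl) <;> simp
  have h1 : ∀ i ≤ N, (mapF γ δ)^[i] s ∉ ({((0 : ℂ) : Sphere), ∞} : Set Sphere) := by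
    intro i hi h
    apply hs
    obtain ⟨j, rfl⟩ := Nat.exists_eq_add_of_le' hi
    rw [Function.iterate_add_apply]
    exact hinv.iterate j h
  simp only [Set.mem_insert_iff, Set.mem_singleton_iff, not_or] at h1
  refine ⟨fun i hi => (h1 i hi).2, fun i hi => ?_, fun i hi h => (h1 i hi).1 ?_⟩
  · have h2 := coe_affine (h1 i hi.le).2
    have h3 := Function.iterate_succ_apply' (mapF γ δ) i s
    set z := affine ((mapF γ δ)^[i] s)
    have hD : z ^ 2 + δ * z + 1 ≠ 0 := by
      intro hD
      rw [← h2, mapF_pole hD] at h3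
      exact (h1 (i + 1) hi).2 h3
    rw [← h2, mapF_coe hD] at h3
    exact ⟨hD, congrArg affine h3⟩
  · rw [← coe_affine (h1 i hi).2]
    exact congrArg _ h

/-! ### Derivatives of iterates -/

/-- The map `f` sends the finite point `x` to the finite point `y`, and it is holomorphic near `x`
with derivative `d` at `x`, in affine coordinates. -/
def HasSphereDeriv (f : Sphere → Sphere) (x y d : ℂ) : Prop :=
  ∃ φ : ℂ → ℂ, (∀ᶠ w : ℂ in 𝓝 x, f (w : Sphere) = (φ w : Sphere)) ∧ φ x = y ∧ HasDerivAt φ d x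

lemma HasSphereDeriv.hasDerivAt {f : Sphere → Sphere} {x y d : ℂ} (h : HasSphereDeriv f x y d) :
    HasDerivAt (fun w : ℂ => affine (f (w : Sphere))) d x := by
  obtain ⟨φ, h1, -, h2⟩ := h
  exact h2.congr_of_eventuallyEq (h1.mono fun w hw => by simp [hw])

lemma HasSphereDeriv.comp {f g : Sphere → Sphere} {x y z d e : ℂ} (hg : HasSphereDeriv g y z e)
    (hf : HasSphereDeriv f x y d) : HasSphereDeriv (g ∘ f) x z (e * d) := by
  obtain ⟨φ, h1, rfl, h3⟩ := hf
  obtain ⟨ψ, h4, rfl, h6⟩ := hg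
  refine ⟨ψ ∘ φ, ?_, rfl, h6.comp x h3⟩
  filter_upwards [h1, h3.continuousAt.eventually h4] with w h7 h8
  simp [h7, h8]

lemma HasSphereDeriv.iterate {f : Sphere → Sphere} {x d : ℕ → ℂ} {N : ℕ}
    (h : ∀ i < N, HasSphereDeriv f (x i) (x (i + 1)) (d i)) :
    HasSphereDeriv f^[N] (x 0) (x N) (∏ i ∈ Finset.range N, d i) := by
  induction N with
  | zero => exact ⟨id, by simp, rfl, by simpa using hasDerivAt_id _⟩
  | succ N ih =>
    rw [Function.iterate_succ', Finset.prod_range_succ, mul_comm]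
    exact (h N (by omega)).comp (ih fun i hi => h i (by omega))

lemma hasSphereDeriv_mapF {γ δ z : ℂ} (hD : z ^ 2 + δ * z + 1 ≠ 0) :
    HasSphereDeriv (mapF γ δ) z (γ * z / (z ^ 2 + δ * z + 1))
      (γ * (1 - z ^ 2) / (z ^ 2 + δ * z + 1) ^ 2) := by
  refine ⟨fun w => γ * w / (w ^ 2 + δ * w + 1), ?_, rfl, ?_⟩
  · have h1 : ContinuousAt (fun w : ℂ => w ^ 2 + δ * w + 1) z := by fun_prop
    filter_upwards [h1.eventually_ne hD] with w hw
    exact mapF_coe hw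
  · have h1 : HasDerivAt (fun w : ℂ => w ^ 2 + δ * w + 1) (2 * z + δ) z := by
      simpa using (((hasDerivAt_id z).pow 2).add ((hasDerivAt_id z).const_mul δ)).add_const 1
    refine (((hasDerivAt_id z).const_mul γ).div h1 hD).congr_deriv ?_
    simp only [id]
    ring

lemma hasSphereDeriv_mapG {T z : ℂ} (hz : z ≠ 0) :
    HasSphereDeriv (mapG T) z (z + T + 1 / z) (1 - 1 / z ^ 2) := by
  refine ⟨fun w => w + T + 1 / w, ?_, rfl, ?_⟩
  · filter_upwards [isOpen_ne.mem_nhds hz] with w hw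
    exact mapG_coe hw
  · simp only [one_div]
    exact (((hasDerivAt_id z).add_const T).add (hasDerivAt_inv hz)).congr_deriv
      (sub_eq_add_neg _ _).symm

lemma IsAffineOrbit.hasSphereDeriv {γ δ : ℂ} {N : ℕ} {x : ℕ → ℂ} (h : IsAffineOrbit γ δ N x) :
    HasSphereDeriv (mapF γ δ)^[N] (x 0) (x N)
      (∏ i ∈ Finset.range N, γ * (1 - x i ^ 2) / (x i ^ 2 + δ * x i + 1) ^ 2) := by
  refine HasSphereDeriv.iterate (d := fun i => γ * (1 - x i ^ 2) / (x i ^ 2 + δ * x i + 1) ^ 2)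
    fun i hi => ?_
  rw [(h.1 i hi).2]
  exact hasSphereDeriv_mapF (h.1 i hi).1

/-! ### Growth of the multiplier near the origin -/

/-- The derivative of `F` in the conformal metric `|dz| / (|γ| + |z|²)` is bounded below by
`|1 - z²| / (K (|z|² + 1 / |γ|))`, so that it is large near `0` and bounded away from `0` far from
the critical points. -/
lemma one_le_metric_derivative_mul {γ δ z : ℂ} {C : ℝ} (hγ : γ ≠ 0) (hC : 0 ≤ C)
    (hδ : ‖δ‖ ^ 2 ≤ C * ‖γ‖) (hD : z ^ 2 + δ * z + 1 ≠ 0) (h1 : 1 - z ^ 2 ≠ 0) :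
    1 ≤ ‖γ * (1 - z ^ 2) / (z ^ 2 + δ * z + 1) ^ 2‖ * ((‖γ‖ + ‖z‖ ^ 2) /
        (‖γ‖ + ‖γ * z / (z ^ 2 + δ * z + 1)‖ ^ 2)) *
      ((3 * C + 3) * (‖z‖ ^ 2 + ‖γ‖⁻¹) / ‖1 - z ^ 2‖) := by
  have hg : 0 < ‖γ‖ := norm_pos_iff.2 hγ
  have hd : 0 < ‖z ^ 2 + δ * z + 1‖ := norm_pos_iff.2 hD
  have he : 0 < ‖1 - z ^ 2‖ := norm_pos_iff.2 h1
  have h2 : ‖z ^ 2 + δ * z + 1‖ ^ 2 ≤ 3 * (‖z‖ ^ 4 + C * ‖γ‖ * ‖z‖ ^ 2 + 1) := by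
    have h3 : ‖z ^ 2 + δ * z + 1‖ ≤ ‖z‖ ^ 2 + ‖δ‖ * ‖z‖ + 1 := by
      refine (norm_add_le _ _).trans ?_
      rw [norm_one, ← norm_pow, ← norm_mul]
      gcongr
      exact norm_add_le _ _
    have h4 : ‖δ‖ ^ 2 * ‖z‖ ^ 2 ≤ C * ‖γ‖ * ‖z‖ ^ 2 := by gcongr
    have h5 : ‖z ^ 2 + δ * z + 1‖ ^ 2 ≤ (‖z‖ ^ 2 + ‖δ‖ * ‖z‖ + 1) ^ 2 := by gcongr
    nlinarith [sq_nonneg (‖z‖ ^ 2 - ‖δ‖ * ‖z‖), sq_nonneg (‖z‖ ^ 2 - 1),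
      sq_nonneg (‖δ‖ * ‖z‖ - 1)]
  have hden : 0 < ‖z ^ 2 + δ * z + 1‖ ^ 2 + ‖γ‖ * ‖z‖ ^ 2 := by positivity
  have h6 : ‖γ * (1 - z ^ 2) / (z ^ 2 + δ * z + 1) ^ 2‖ * ((‖γ‖ + ‖z‖ ^ 2) /
        (‖γ‖ + ‖γ * z / (z ^ 2 + δ * z + 1)‖ ^ 2)) *
      ((3 * C + 3) * (‖z‖ ^ 2 + ‖γ‖⁻¹) / ‖1 - z ^ 2‖) =
      (‖γ‖ + ‖z‖ ^ 2) * ((3 * C + 3) * (‖z‖ ^ 2 + ‖γ‖⁻¹)) /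
        (‖z ^ 2 + δ * z + 1‖ ^ 2 + ‖γ‖ * ‖z‖ ^ 2) := by
    simp only [norm_div, norm_mul, norm_pow]
    generalize ‖z ^ 2 + δ * z + 1‖ = d at hd hden
    have h7 : ‖γ‖ + (‖γ‖ * ‖z‖ / d) ^ 2 = ‖γ‖ * (d ^ 2 + ‖γ‖ * ‖z‖ ^ 2) / d ^ 2 := by
      field_simp
    rw [h7]
    field_simp
  rw [h6, le_div_iff₀ hden, one_mul]
  have h8 : (‖γ‖ + ‖z‖ ^ 2) * ((3 * C + 3) * (‖z‖ ^ 2 + ‖γ‖⁻¹)) =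
      (3 * C + 3) * (‖z‖ ^ 4 + ‖γ‖ * ‖z‖ ^ 2 + 1 + ‖z‖ ^ 2 * ‖γ‖⁻¹) := by
    field_simp; ring
  rw [h8]
  have h9 : 0 ≤ ‖γ‖ * ‖z‖ ^ 2 := by positivity
  have h10 : 0 ≤ C * ‖z‖ ^ 4 := by positivity
  have h11 : 0 ≤ (3 * C + 3) * (‖z‖ ^ 2 * ‖γ‖⁻¹) := by positivity
  nlinarith

lemma prod_range_div_succ {K : Type*} [Field K] {f : ℕ → K} (hf : ∀ i, f i ≠ 0) (N : ℕ) :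
    ∏ i ∈ Finset.range N, f i / f (i + 1) = f 0 / f N := by
  induction N with
  | zero => simp [hf]
  | succ N ih => rw [Finset.prod_range_succ, ih, div_mul_div_cancel₀ (hf N)]

lemma exists_tendsto_metric_bound {l : Filter ℕ} {g : ℕ → ℝ} (hg : Tendsto (fun k => (g k)⁻¹) l (𝓝 0))
    {x : ℕ → ℂ} {s : Sphere} (hx : Tendsto (fun k => (x k : Sphere)) l (𝓝 s))
    (h0 : ∀ k, x k ≠ 0) (hs : ∀ χ : ℂ, (χ = 1 ∨ χ = -1) → s ≠ (χ : Sphere)) (K : ℝ) :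
    ∃ c : ℝ, Tendsto (fun k => K * (‖x k‖ ^ 2 + (g k)⁻¹) / ‖1 - x k ^ 2‖) l (𝓝 c) ∧
      (s = ((0 : ℂ) : Sphere) → c = 0) ∧ ∀ᶠ k in l, 1 - x k ^ 2 ≠ 0 := by
  by_cases h : s = ∞
  · subst h
    have h1 := tendsto_inv_of_tendsto_infty hx
    have h2 := ((hg.mul (h1.norm.pow 2)).const_add 1).const_mul K
    have h3 := ((h1.pow 2).sub_const 1)
    have h4 : ‖(0 : ℂ) ^ 2 - 1‖ ≠ 0 := by norm_num
    refine ⟨_, (h2.div h3.norm h4).congr fun k => ?_, by simp, ?_⟩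
    · have hxk := h0 k
      have h5 : (x k)⁻¹ ^ 2 - 1 = (1 - x k ^ 2) / x k ^ 2 := by field_simp
      have h6 := norm_pos_iff.2 hxk
      rw [Pi.div_apply, h5, norm_inv, norm_div, norm_pow]
      field_simp
    · filter_upwards [h3.eventually_ne (b₂ := 0) (by norm_num)] with k hk h6
      apply hk
      rw [inv_pow, ← sub_eq_zero.1 h6, inv_one, sub_self]
  · obtain ⟨ζ, rfl⟩ := OnePoint.ne_infty_iff_exists.1 h
    rw [tendsto_coe_iff] at hx
    have h1 : (1 - ζ ^ 2) ≠ 0 := by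
      intro h2
      have h3 : (ζ - 1) * (ζ + 1) = 0 := by linear_combination -h2
      rcases mul_eq_zero.1 h3 with h4 | h4
      · exact hs 1 (Or.inl rfl) (by rw [sub_eq_zero.1 h4])
      · exact hs (-1) (Or.inr rfl) (by rw [eq_neg_of_add_eq_zero_left h4])
    have h2 := (hx.pow 2).const_sub 1
    refine ⟨_, (((hx.norm.pow 2).add hg).const_mul K).div h2.norm (norm_ne_zero_iff.2 h1), ?_,
      h2.eventually_ne h1⟩
    intro h3
    rw [coe_inj.1 h3]
    simp

/-- If a sequence of `n`-cycles accumulates at `0` with bounded multipliers, it accumulates at a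
critical point. -/
lemma exists_critical_limit {l : Filter ℕ} [l.NeBot] {γ δ a b : ℕ → ℂ} {ω : ℂ}
    (h : Degenerating l γ δ a b ω) {n : ℕ} {x : ℕ → ℕ → ℂ}
    (hx : ∀ k, IsAffineOrbit (γ k) (δ k) n (x k)) (hper : ∀ k, x k n = x k 0) {ρ : ℂ}
    (hρ : Tendsto (fun k => ∏ i ∈ Finset.range n,
      γ k * (1 - x k i ^ 2) / (x k i ^ 2 + δ k * x k i + 1) ^ 2) l (𝓝 ρ))
    {L : ℕ → Sphere} (hL : ∀ i < n, Tendsto (fun k => (x k i : Sphere)) l (𝓝 (L i)))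
    {j : ℕ} (hj : j < n) (h0 : L j = ((0 : ℂ) : Sphere)) :
    ∃ i < n, ∃ χ : ℂ, (χ = 1 ∨ χ = -1) ∧ L i = (χ : Sphere) := by
  by_contra! hne
  obtain ⟨C, hC, hδ⟩ := h.delta_bound
  have hg : Tendsto (fun k => ‖γ k‖⁻¹) l (𝓝 0) := by simpa using h.inv_gamma.norm
  have hB : ∀ i : ℕ, ∃ c : ℝ, i < n →
      (Tendsto (fun k => (3 * C + 3) * (‖x k i‖ ^ 2 + ‖γ k‖⁻¹) / ‖1 - x k i ^ 2‖) l (𝓝 c) ∧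
      (L i = ((0 : ℂ) : Sphere) → c = 0) ∧ ∀ᶠ k in l, 1 - x k i ^ 2 ≠ 0) := by
    intro i
    by_cases hi : i < n
    · obtain ⟨c, hc⟩ := exists_tendsto_metric_bound hg (hL i hi) (fun k => (hx k).2 i hi.le)
        (hne i hi) (3 * C + 3)
      exact ⟨c, fun _ => hc⟩
    · exact ⟨0, fun h => absurd h hi⟩
  choose c hc using hB
  have h1 := hρ.norm.mul (tendsto_finsetProd (Finset.range n) fun i hi =>
    (hc i (Finset.mem_range.1 hi)).1)
  rw [Finset.prod_eq_zero (Finset.mem_range.2 hj) ((hc j hj).2.1 h0), mul_zero] at h1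
  have h2 : ∀ᶠ k in l, ∀ i ∈ Finset.range n, 1 - x k i ^ 2 ≠ 0 :=
    (Finset.range n).eventually_all.2 fun i hi => (hc i (Finset.mem_range.1 hi)).2.2
  refine absurd (ge_of_tendsto h1 ?_) (not_le.2 (zero_lt_one (α := ℝ)))
  filter_upwards [h2, hδ] with k h2 hδ
  -- The metric densities cancel along the cycle.
  have h3 : ∏ i ∈ Finset.range n, ((‖γ k‖ + ‖x k i‖ ^ 2) / (‖γ k‖ + ‖x k (i + 1)‖ ^ 2)) = 1 := by
    have h4 : ∀ i, ‖γ k‖ + ‖x k i‖ ^ 2 ≠ 0 := fun i => by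
      have := norm_pos_iff.2 (h.ne_zero k)
      positivity
    rw [prod_range_div_succ h4, hper, div_self (h4 0)]
  have h5 : 1 ≤ ∏ i ∈ Finset.range n,
      (‖γ k * (1 - x k i ^ 2) / (x k i ^ 2 + δ k * x k i + 1) ^ 2‖ *
        ((‖γ k‖ + ‖x k i‖ ^ 2) / (‖γ k‖ + ‖x k (i + 1)‖ ^ 2)) *
        ((3 * C + 3) * (‖x k i‖ ^ 2 + ‖γ k‖⁻¹) / ‖1 - x k i ^ 2‖)) := by
    refine Finset.prod_induction _ (fun r : ℝ => (1 : ℝ) ≤ r)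
      (fun r s hr hs => one_le_mul_of_one_le_of_one_le hr hs) le_rfl fun i hi => ?_
    have h4 := (hx k).1 i (Finset.mem_range.1 hi)
    rw [h4.2]
    exact one_le_metric_derivative_mul (h.ne_zero k) hC hδ h4.1 (h2 i hi)
  rwa [Finset.prod_mul_distrib, Finset.prod_mul_distrib, h3, mul_one, ← norm_prod] at h5

/-! ### Limits of maps and of sets -/

/-- Locally uniform convergence to a continuous map implies joint convergence in the index and the
point. -/
lemma TendsToLocallyUniformlyOn.tendsto_prod {f : ℕ → Sphere → Sphere} {g : Sphere → Sphere}
    {S : Set Sphere} (h : TendsToLocallyUniformlyOn f g S) (hS : IsOpen S) {s : Sphere}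
    (hs : s ∈ S) (hg : ContinuousAt g s) :
    Tendsto (fun p : ℕ × Sphere => f p.1 p.2) (atTop ×ˢ 𝓝 s) (𝓝 (g s)) := by
  let _ : UniformSpace Sphere := uniformSpaceOfCompactR1
  refine tendsto_comp_of_locally_uniform_limit (F := fun p : ℕ × Sphere => f p.1) hg tendsto_snd
    fun u hu => ?_
  obtain ⟨t, ht, h1⟩ := h u hu s hs
  exact ⟨t, hS.nhdsWithin_eq hs ▸ ht, tendsto_fst.eventually h1⟩

lemma isOpen_compl_zero_infty : IsOpen ({((0 : ℂ) : Sphere), ∞} : Set Sphere)ᶜ :=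
  (Set.toFinite _).isClosed.isOpen_compl

lemma coe_mem_compl {z : ℂ} :
    (z : Sphere) ∈ ({((0 : ℂ) : Sphere), ∞} : Set Sphere)ᶜ ↔ z ≠ 0 := by
  simp

lemma exists_coe_of_mem_compl {s : Sphere} (hs : s ∈ ({((0 : ℂ) : Sphere), ∞} : Set Sphere)ᶜ) :
    ∃ z : ℂ, z ≠ 0 ∧ s = (z : Sphere) := by
  simp only [Set.mem_compl_iff, Set.mem_insert_iff, Set.mem_singleton_iff, not_or] at hs
  obtain ⟨z, rfl⟩ := OnePoint.ne_infty_iff_exists.1 hs.2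
  exact ⟨z, fun h => hs.1 (by rw [h]), rfl⟩

lemma mapG_ne_infty {T : ℂ} {s : Sphere} (hs : s ∈ ({((0 : ℂ) : Sphere), ∞} : Set Sphere)ᶜ) :
    mapG T s ≠ ∞ := by
  obtain ⟨z, hz, rfl⟩ := exists_coe_of_mem_compl hs
  rw [mapG_coe hz]
  exact OnePoint.coe_ne_infty _

lemma continuousAt_mapG_iterate {T : ℂ} {s : Sphere} {m : ℕ}
    (h : ∀ i < m, (mapG T)^[i] s ∈ ({((0 : ℂ) : Sphere), ∞} : Set Sphere)ᶜ) :
    ContinuousAt (mapG T)^[m] s := by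
  induction m with
  | zero => exact continuousAt_id
  | succ m ih =>
    rw [Function.iterate_succ']
    exact (continuousAt_mapG (h m (by omega))).comp (ih fun i hi => h i (by omega))

/-- The limit set of a sequence of sets with `n` points consists of the limits of these points along
any filter along which they converge. -/
lemma SetsTendTo.eq_image {C : ℕ → Set Sphere} {Z : Set Sphere} (h : SetsTendTo C Z)
    {l : Filter ℕ} [l.NeBot] (hl : l ≤ atTop) {n : ℕ} {y : ℕ → ℕ → Sphere} {L : ℕ → Sphere}
    (hC : ∀ k, C k = y k '' Set.Iio n) (hL : ∀ i, Tendsto (fun k => y k i) l (𝓝 (L i))) :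
    Z = L '' Set.Iio n := by
  have h1 : Z ⊆ L '' Set.Iio n := by
    intro ζ hζ
    by_contra hne
    have h2 : ∀ i : ℕ, ∃ U ∈ 𝓝 ζ, i < n → ∀ᶠ k in l, y k i ∉ U := by
      intro i
      by_cases hi : i < n
      · have h3 : L i ≠ ζ := fun h => hne ⟨i, hi, h⟩
        obtain ⟨V, hV, U, hU, hd⟩ := Filter.disjoint_iff.1 (disjoint_nhds_nhds.2 h3)
        exact ⟨U, hU, fun _ => ((hL i).eventually hV).mono fun k hk =>
          Set.disjoint_left.1 hd hk⟩
      · exact ⟨Set.univ, univ_mem, fun h => absurd h hi⟩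
    choose U hU hy using h2
    have h3 : ∀ᶠ k in l, (C k ∩ ⋂ i ∈ Finset.range n, U i).Nonempty :=
      hl (h.1 ζ hζ _ ((Filter.biInter_finset_mem _).2 fun i _ => hU i))
    have h4 : ∀ᶠ k in l, ∀ i ∈ Finset.range n, y k i ∉ U i :=
      (Finset.range n).eventually_all.2 fun i hi => hy i (Finset.mem_range.1 hi)
    obtain ⟨k, ⟨s, hs, hsU⟩, hk⟩ := (h3.and h4).exists
    rw [hC] at hs
    obtain ⟨i, hi, rfl⟩ := hs
    have hi' := Finset.mem_range.2 hi
    exact hk i hi' (Set.mem_iInter₂.1 hsU i hi')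
  refine h1.antisymm ?_
  rintro _ ⟨i, hi, rfl⟩
  by_contra hne
  have hZ : IsCompact Z := (((Set.finite_Iio n).image L).subset h1).isCompact
  obtain ⟨U, V, hU, hV, hZU, hiV, hd⟩ := hZ.separation_of_notMem hne
  have h2 : ∀ᶠ k in l, C k ⊆ U := hl (h.2 U hU hZU)
  obtain ⟨k, hk1, hk2⟩ := (h2.and ((hL i).eventually (hV.mem_nhds hiV))).exists
  rw [hC] at hk1
  exact Set.disjoint_left.1 hd (hk1 ⟨i, hi, rfl⟩) hk2

/-! ### Limits of cycles -/

lemma Degenerating.delta_div {l : Filter ℕ} {γ δ a b : ℕ → ℂ} {ω : ℂ}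
    (h : Degenerating l γ δ a b ω) : Tendsto (fun k => δ k / γ k) l (𝓝 0) := by
  have h1 := (h.inv_a.mul (h.sq_div.add h.prod_div)).neg
  rw [zero_mul, neg_zero] at h1
  refine h1.congr' ?_
  filter_upwards [h.a_ne_zero] with k ha
  have hγ := h.ne_zero k
  have h2 : δ k = -(a k + b k) := by rw [h.sum]; ring
  rw [h2]
  field_simp

/-- The convergence `F_k^q → G_T`, jointly in `k` along `l` and in the point, on the
complement of `{0, ∞}`. -/
def IterateTendsto (l : Filter ℕ) (γ δ : ℕ → ℂ) (q : ℕ) (T : ℂ) : Prop :=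
  ∀ s ∈ ({((0 : ℂ) : Sphere), ∞} : Set Sphere)ᶜ,
    Tendsto (fun p : ℕ × Sphere => (mapF (γ p.1) (δ p.1))^[q] p.2) (l ×ˢ 𝓝 s) (𝓝 (mapG T s))

lemma IterateTendsto.iterate {l : Filter ℕ} {γ δ : ℕ → ℂ} {q : ℕ} {T : ℂ}
    (h : IterateTendsto l γ δ q T) {s : Sphere} {m : ℕ}
    (hs : ∀ i < m, (mapG T)^[i] s ∈ ({((0 : ℂ) : Sphere), ∞} : Set Sphere)ᶜ) :
    Tendsto (fun p : ℕ × Sphere => (mapF (γ p.1) (δ p.1))^[m * q] p.2) (l ×ˢ 𝓝 s)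
      (𝓝 ((mapG T)^[m] s)) := by
  induction m with
  | zero => simpa using tendsto_snd
  | succ m ih =>
    rw [Function.iterate_succ_apply']
    refine ((h _ (hs m (by omega))).comp
      (tendsto_fst.prodMk (ih fun i hi => hs i (by omega)))).congr fun p => ?_
    rw [Function.comp_apply, ← Function.iterate_add_apply]
    congr 2
    ring

/-- The convergence of the maps determines the asymptotics of `(a / b) ^ q`. -/
lemma IterateTendsto.drift {l : Filter ℕ} {γ δ a b : ℕ → ℂ} {ω T : ℂ} {q : ℕ}
    (h : IterateTendsto l γ δ q T) (hd : Degenerating l γ δ a b ω) (hω : IsPrimitiveRoot ω q)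
    (hω1 : ω ≠ 1) (hq : 0 < q) :
    Tendsto (fun k => ((a k / b k) ^ q - 1) / ((b k)⁻¹ - (a k)⁻¹)) l (𝓝 T) := by
  -- A test point whose image under `G_T` is neither `0` nor `∞`, so that its orbit stays finite.
  obtain ⟨χ, hχ, hGχ⟩ : ∃ χ : ℂ, χ ≠ 0 ∧ χ + T + 1 / χ ≠ 0 := by
    by_cases hT : T = -2
    · exact ⟨-1, by norm_num, by rw [hT]; norm_num⟩
    · exact ⟨1, one_ne_zero, fun h => hT (by linear_combination h)⟩
  have h1 : Tendsto (fun k => (mapF (γ k) (δ k))^[q] (χ : Sphere)) l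
      (𝓝 ((χ + T + 1 / χ : ℂ) : Sphere)) := by
    have := (h χ (coe_mem_compl.2 hχ)).comp (tendsto_id.prodMk tendsto_const_nhds)
    rwa [mapG_coe hχ] at this
  have h2 := h1.eventually (isOpen_compl_zero_infty.mem_nhds (coe_mem_compl.2 hGχ))
  have h3 := hd.drift hω hω1 hq (x := fun k i => affine ((mapF (γ k) (δ k))^[i] (χ : Sphere)))
    (h2.mono fun k hk => (isAffineOrbit_of_iterate hk).2) hχ
    (by simpa using tendsto_const_nhds) ((continuousAt_affine _).tendsto.comp h1)
  convert h3 using 2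
  rw [affine_coe]
  ring

/-- A sequence of `n`-cycles `x k 0, x k 1, …` of the maps `F_{γ_k,δ_k}`, with limit points `L i`
along `l`, in the situation where `F_k^q → G_T`. -/
structure LimitCycle (l : Filter ℕ) (γ δ a b : ℕ → ℂ) (ω T : ℂ) (q n : ℕ) (x : ℕ → ℕ → ℂ)
    (L : ℕ → Sphere) : Prop where
  degenerating : Degenerating l γ δ a b ω
  prim : IsPrimitiveRoot ω q
  omega_ne_one : ω ≠ 1
  q_pos : 0 < q
  one_lt_n : 1 < n
  iterate : IterateTendsto l γ δ q T
  orbit : ∀ k N, IsAffineOrbit (γ k) (δ k) N (x k)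
  map_iterate : ∀ k i j, (mapF (γ k) (δ k))^[j] (x k i : Sphere) = (x k (i + j) : Sphere)
  periodic : ∀ k i, x k (i + n) = x k i
  aperiodic : ∀ k i t, 0 < t → t < n → x k (i + t) ≠ x k i
  tendsto : ∀ i, Tendsto (fun k => (x k i : Sphere)) l (𝓝 (L i))

namespace LimitCycle

variable {l : Filter ℕ} {γ δ a b : ℕ → ℂ} {ω T : ℂ} {q n : ℕ} {x : ℕ → ℕ → ℂ} {L : ℕ → Sphere}

lemma one_lt_q (h : LimitCycle l γ δ a b ω T q n x L) : 1 < q := by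
  by_contra hq
  have h1 : q = 1 := by have := h.q_pos; omega
  have h2 := h.prim.pow_eq_one
  rw [h1, pow_one] at h2
  exact h.omega_ne_one h2

lemma orbit_shift (h : LimitCycle l γ δ a b ω T q n x L) (k j N : ℕ) :
    IsAffineOrbit (γ k) (δ k) N (fun i => x k (j + i)) :=
  ⟨fun i hi => (h.orbit k (j + N)).1 (j + i) (by omega),
    fun i hi => (h.orbit k (j + N)).2 (j + i) (by omega)⟩

lemma x_ne_zero (h : LimitCycle l γ δ a b ω T q n x L) (k i : ℕ) : x k i ≠ 0 :=
  (h.orbit k i).2 i le_rfl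

lemma L_add_n [l.NeBot] (h : LimitCycle l γ δ a b ω T q n x L) (i : ℕ) : L (i + n) = L i :=
  tendsto_nhds_unique (h.tendsto (i + n)) ((h.tendsto i).congr fun k => by rw [h.periodic])

lemma L_add_mul [l.NeBot] (h : LimitCycle l γ δ a b ω T q n x L) (i t : ℕ) :
    L (i + t * n) = L i := by
  induction t with
  | zero => simp
  | succ t ih => rw [add_mul, one_mul, ← add_assoc, h.L_add_n, ih]

lemma step [l.NeBot] (h : LimitCycle l γ δ a b ω T q n x L) {j : ℕ}
    (hj : L j ∈ ({((0 : ℂ) : Sphere), ∞} : Set Sphere)ᶜ) : L (j + q) = mapG T (L j) := by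
  refine tendsto_nhds_unique (h.tendsto (j + q)) ?_
  refine ((h.iterate _ hj).comp (tendsto_id.prodMk (h.tendsto j))).congr fun k => ?_
  exact h.map_iterate k j q

lemma eq_infty [l.NeBot] (h : LimitCycle l γ δ a b ω T q n x L) {j r : ℕ}
    (hj : L j ∈ ({((0 : ℂ) : Sphere), ∞} : Set Sphere)ᶜ) (hr : 0 < r) (hrq : r < q) :
    L (j + r) = ∞ := by
  obtain ⟨ζ, hζ, hL⟩ := exists_coe_of_mem_compl hj
  have h1 := h.tendsto j
  rw [hL, tendsto_coe_iff] at h1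
  have h2 := h.degenerating.escape h.prim h.omega_ne_one (x := fun k i => x k (j + i)) (N := r)
    (Eventually.of_forall fun k => h.orbit_shift k j r) hζ h1 le_rfl hr hrq
  exact tendsto_nhds_unique (h.tendsto (j + r))
    (tendsto_infty_of_tendsto_inv h2 (Eventually.of_forall fun k => h.x_ne_zero k _))

/-- Since `0` is strongly repelling, a cycle cannot collapse to `0`; a limit point in `ℂ \ {0}` is
followed by `∞`. -/
lemma exists_eq_infty [l.NeBot] (h : LimitCycle l γ δ a b ω T q n x L) : ∃ j, L j = ∞ := by
  by_cases h0 : ∃ j, L j ≠ ((0 : ℂ) : Sphere)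
  · obtain ⟨j, hj⟩ := h0
    by_cases hj1 : L j = ∞
    · exact ⟨j, hj1⟩
    · exact ⟨j + 1, h.eq_infty (by simp [hj, hj1]) one_pos h.one_lt_q⟩
  · push Not at h0
    exfalso
    have h1 : ∀ i, Tendsto (fun k => x k i / x k (i + 1)) l (𝓝 0) := by
      intro i
      have h2 := h.tendsto i
      rw [h0, tendsto_coe_iff] at h2
      have h3 := ((h.degenerating.inv_gamma.mul (h2.pow 2)).add
        (h.degenerating.delta_div.mul h2)).add h.degenerating.inv_gamma
      rw [zero_mul, zero_mul, add_zero, add_zero] at h3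
      refine h3.congr fun k => ?_
      have h4 := (h.orbit k (i + 1)).1 i (by omega)
      have h5 := h.x_ne_zero k i
      have h6 := h.degenerating.ne_zero k
      rw [h4.2, div_div_eq_mul_div]
      field_simp
    have h2 := tendsto_finsetProd (Finset.range n) fun i _ => h1 i
    rw [Finset.prod_eq_zero (Finset.mem_range.2 (show 0 < n by have := h.one_lt_n; omega)) rfl]
      at h2
    refine zero_ne_one (tendsto_nhds_unique h2 (tendsto_const_nhds.congr fun k => ?_))
    have h3 := h.periodic k 0
    rw [zero_add] at h3
    rw [prod_range_div_succ (h.x_ne_zero k), h3, div_self (h.x_ne_zero k 0)]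

lemma follow [l.NeBot] (h : LimitCycle l γ δ a b ω T q n x L) {j m : ℕ}
    (hm : ∀ i < m, L (j + i * q) ∈ ({((0 : ℂ) : Sphere), ∞} : Set Sphere)ᶜ) :
    L (j + m * q) = (mapG T)^[m] (L j) := by
  induction m with
  | zero => simp
  | succ m ih =>
    rw [Function.iterate_succ_apply', ← ih fun i hi => hm i (by omega), ← h.step (hm m (by omega))]
    congr 1
    ring

lemma ne_zero_of_lt [l.NeBot] (h : LimitCycle l γ δ a b ω T q n x L) {j m : ℕ}
    (hm : ∀ i < m, L (j + i * q) ∈ ({((0 : ℂ) : Sphere), ∞} : Set Sphere)ᶜ) {t : ℕ}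
    (ht : t < m * q) : L (j + t) ≠ ((0 : ℂ) : Sphere) := by
  have h1 : t / q < m := Nat.div_lt_of_lt_mul (by rwa [mul_comm])
  have h2 := Nat.div_add_mod' t q
  by_cases hr : t % q = 0
  · rw [hr, add_zero] at h2
    have := hm _ h1
    rw [h2] at this
    exact fun h3 => this (Or.inl h3)
  · rw [← h2, ← add_assoc, h.eq_infty (hm _ h1) (Nat.pos_of_ne_zero hr) (Nat.mod_lt _ h.q_pos)]
    exact OnePoint.infty_ne_coe _

lemma image_eq_range [l.NeBot] (h : LimitCycle l γ δ a b ω T q n x L) :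
    L '' Set.Iio n = Set.range L := by
  refine (Set.image_subset_range _ _).antisymm ?_
  rintro _ ⟨i, rfl⟩
  refine ⟨i % n, Nat.mod_lt _ (by have := h.one_lt_n; omega), ?_⟩
  rw [← h.L_add_mul (i % n) (i / n), Nat.mod_add_div']

lemma mapsTo [l.NeBot] (h : LimitCycle l γ δ a b ω T q n x L) :
    mapG T '' Set.range L ⊆ Set.range L := by
  rintro _ ⟨_, ⟨j, rfl⟩, rfl⟩
  by_cases hj : L j ∈ ({((0 : ℂ) : Sphere), ∞} : Set Sphere)ᶜ
  · exact ⟨j + q, h.step hj⟩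
  · obtain ⟨i, hi⟩ := h.exists_eq_infty
    refine ⟨i, ?_⟩
    rw [Set.mem_compl_iff, not_not] at hj
    rcases hj with hj | hj
    · rw [hi, hj, mapG_zero]
    · rw [hi, hj, mapG_infty]

lemma translation_eq_zero [l.NeBot] (h : LimitCycle l γ δ a b ω T q n x L)
    (hL : ∀ i, L i = ∞) : T = 0 := by
  have hfix : ∀ k (c d : ℂ), c + d = -δ k → c * d = 1 - γ k → x k 0 ≠ c := by
    rintro k c d hs hp rfl
    refine h.aperiodic k 0 1 one_pos h.one_lt_n ?_
    have h1 := (h.orbit k 1).1 0 one_pos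
    have h2 : x k 0 ^ 2 + δ k * x k 0 + 1 = γ k := by
      linear_combination x k 0 * hs - hp
    rw [h1.2, h2, mul_div_cancel_left₀ _ (h.degenerating.ne_zero k)]
  refine tendsto_nhds_unique
    (h.iterate.drift h.degenerating h.prim h.omega_ne_one h.q_pos)
    (h.degenerating.drift_of_escaping_cycle h.prim h.omega_ne_one (n := n) (x := x)
      (by have := h.one_lt_n; omega) (Eventually.of_forall fun k => h.orbit k n)
      (Eventually.of_forall fun k => by simpa using h.periodic k 0)
      (Eventually.of_forall fun k => hfix k _ _ (h.degenerating.sum k) (h.degenerating.prod k))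
      (Eventually.of_forall fun k => hfix k _ (a k)
        (by rw [add_comm]; exact h.degenerating.sum k)
        (by rw [mul_comm]; exact h.degenerating.prod k))
      fun i _ => tendsto_inv_of_tendsto_infty (by simpa [hL i] using h.tendsto i))

/-- When `0` is a limit point, the multipliers stay bounded only if a critical point is one too.
Its orbit under `G_T` ends at `0`, for otherwise the cycle would follow it and never come near
`0`. -/
lemma critical_orbit [l.NeBot] (h : LimitCycle l γ δ a b ω T q n x L) {ρ : ℂ}
    (hρ : Tendsto (fun k => ∏ i ∈ Finset.range n,
      γ k * (1 - x k i ^ 2) / (x k i ^ 2 + δ k * x k i + 1) ^ 2) l (𝓝 ρ))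
    (h0 : ((0 : ℂ) : Sphere) ∈ Set.range L) :
    ∃ χ : ℂ, (χ = 1 ∨ χ = -1) ∧ ∃ m : ℕ, 1 ≤ m ∧ m * q < n ∧
      (mapG T)^[m] (χ : Sphere) = ((0 : ℂ) : Sphere) := by
  have hn := h.one_lt_n
  obtain ⟨i, hi⟩ := h0
  rw [← Nat.mod_add_div' i n, h.L_add_mul] at hi
  obtain ⟨j, -, χ, hχ, hj⟩ := exists_critical_limit h.degenerating (fun k => h.orbit k n)
    (fun k => by simpa using h.periodic k 0) hρ (fun i _ => h.tendsto i)
    (Nat.mod_lt i (by omega)) hi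
  have hχ0 : L j ∈ ({((0 : ℂ) : Sphere), ∞} : Set Sphere)ᶜ := by
    rw [hj, coe_mem_compl]
    rintro rfl
    norm_num at hχ
  have hex : ∃ m, L (j + m * q) ∉ ({((0 : ℂ) : Sphere), ∞} : Set Sphere)ᶜ := by
    by_contra! hall
    have h1 : i % n + j * n = j + (i % n + j * n - j) := by
      have := Nat.le_mul_of_pos_right j (show 0 < n by omega)
      omega
    rw [← h.L_add_mul (i % n) j, h1] at hi
    exact h.ne_zero_of_lt (m := i % n + j * n - j + 1) (fun i _ => hall i)
      (lt_of_lt_of_le (Nat.lt_succ_self _) (Nat.le_mul_of_pos_right _ h.q_pos)) hi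
  classical
  have hm := Nat.find_spec hex
  have hlt : ∀ i < Nat.find hex, L (j + i * q) ∈ ({((0 : ℂ) : Sphere), ∞} : Set Sphere)ᶜ :=
    fun i hi => not_not.1 (Nat.find_min hex hi)
  have hpos : 1 ≤ Nat.find hex := (Nat.find_pos hex).2 (by simpa using hχ0)
  generalize Nat.find hex = m at hm hlt hpos
  have hzero : L (j + m * q) = ((0 : ℂ) : Sphere) := by
    rw [Set.mem_compl_iff, not_not] at hm
    refine hm.resolve_right fun h1 => ?_
    obtain ⟨t, rfl⟩ := Nat.exists_eq_add_of_le' hpos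
    have h2 := h.step (hlt t (by omega))
    rw [add_assoc, ← Nat.succ_mul] at h2
    exact mapG_ne_infty (hlt t (by omega)) (h2.symm.trans h1)
  refine ⟨χ, hχ, m, hpos, ?_, ?_⟩
  · by_contra! hle
    refine h.ne_zero_of_lt hlt (t := m * q - n) (by omega) ?_
    rw [← h.L_add_n, add_assoc, Nat.sub_add_cancel hle, hzero]
  · rw [← hj, ← h.follow hlt, hzero]

end LimitCycle

/-! ### Convergence of derivatives and limiting cycles -/

/-- Along an orbit of `G_T` which avoids `0` and `∞`, the iterates `F_k^(m q)` are eventually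
holomorphic near the starting point, and their derivatives converge to that of `G_T^m`, jointly in
the index and the point. -/
lemma IterateTendsto.tendsto_deriv {l : Filter ℕ} [l.NeBot] {γ δ : ℕ → ℂ} {q : ℕ} {T : ℂ}
    (h : IterateTendsto l γ δ q T) {ζ : ℂ} {m : ℕ}
    (hζ : ∀ i ≤ m, (mapG T)^[i] (ζ : Sphere) ∈ ({((0 : ℂ) : Sphere), ∞} : Set Sphere)ᶜ) :
    Tendsto (fun p : ℕ × ℂ =>
        deriv (fun w : ℂ => affine ((mapF (γ p.1) (δ p.1))^[m * q] (w : Sphere))) p.2)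
      (l ×ˢ 𝓝 ζ) (𝓝 (deriv (fun w : ℂ => affine ((mapG T)^[m] (w : Sphere))) ζ)) ∧
    ∀ᶠ p : ℕ × ℂ in l ×ˢ 𝓝 ζ, DifferentiableAt ℂ
      (fun w : ℂ => affine ((mapF (γ p.1) (δ p.1))^[m * q] (w : Sphere))) p.2 := by
  have hcoe : ∀ z : ℂ, Tendsto (fun p : ℕ × ℂ => (p.1, (p.2 : Sphere))) (l ×ˢ 𝓝 z)
      (l ×ˢ 𝓝 (z : Sphere)) := fun z =>
    tendsto_fst.prodMk (OnePoint.continuous_coe.continuousAt.tendsto.comp tendsto_snd)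
  have hcont : ∀ z : ℂ, Tendsto (fun w : ℂ => (w : Sphere)) (𝓝 z) (𝓝 (z : Sphere)) := fun z =>
    OnePoint.continuous_coe.continuousAt
  have h1 : ∀ᶠ w : ℂ in 𝓝 ζ, ∀ i ∈ Finset.range (m + 1),
      (mapG T)^[i] (w : Sphere) ∈ ({((0 : ℂ) : Sphere), ∞} : Set Sphere)ᶜ := by
    refine (Finset.range (m + 1)).eventually_all.2 fun i hi => ?_
    have him := Finset.mem_range_succ_iff.1 hi
    exact ((continuousAt_mapG_iterate fun t ht => hζ t (by omega)).tendsto.comp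
      (hcont ζ)).eventually (isOpen_compl_zero_infty.mem_nhds (hζ i him))
  have h2 := ((h.iterate fun i hi => hζ i hi.le).comp (hcoe ζ)).eventually
    (isOpen_compl_zero_infty.mem_nhds (hζ m le_rfl))
  obtain ⟨pa, hpa, pb, hpb, hp⟩ := eventually_prod_iff.1 h2
  obtain ⟨V, hV, hVo, hζV⟩ := eventually_nhds_iff.1 (h1.and hpb)
  have hdiff : ∀ᶠ k in l, DifferentiableOn ℂ
      (fun w : ℂ => affine ((mapF (γ k) (δ k))^[m * q] (w : Sphere))) V := by
    filter_upwards [hpa] with k hk w hw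
    have h3 := (isAffineOrbit_of_iterate (hp hk (hV w hw).2)).2.hasSphereDeriv.hasDerivAt
    exact h3.differentiableAt.differentiableWithinAt
  have hGcont : ∀ z ∈ V, ContinuousAt (fun w : ℂ => affine ((mapG T)^[m] (w : Sphere))) z := by
    intro z hz
    obtain ⟨y, -, hy⟩ := exists_coe_of_mem_compl ((hV z hz).1 m (by simp))
    have h3 : Tendsto (fun w : ℂ => (mapG T)^[m] (w : Sphere)) (𝓝 z)
        (𝓝 ((mapG T)^[m] (z : Sphere))) :=
      (continuousAt_mapG_iterate fun t ht => (hV z hz).1 t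
        (Finset.mem_range.2 (by omega))).tendsto.comp (hcont z)
    rw [hy] at h3
    have h4 := (continuousAt_affine y).tendsto.comp h3
    rw [← hy] at h4
    exact h4
  have hunif : TendstoLocallyUniformlyOn
      (fun (k : ℕ) (w : ℂ) => affine ((mapF (γ k) (δ k))^[m * q] (w : Sphere)))
      (fun w : ℂ => affine ((mapG T)^[m] (w : Sphere))) l V := by
    rw [hVo.tendstoLocallyUniformlyOn_iff_forall_tendsto]
    intro z hz
    obtain ⟨y, -, hy⟩ := exists_coe_of_mem_compl ((hV z hz).1 m (by simp))
    have h3 := (h.iterate (m := m) fun i hi => (hV z hz).1 i (Finset.mem_range.2 (by omega))).comp (hcoe z)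
    rw [hy] at h3
    have h4 := (continuousAt_affine y).tendsto.comp h3
    rw [← hy] at h4
    exact (((hGcont z hz).tendsto.comp tendsto_snd).prodMk_nhds h4).mono_right
      (nhds_le_uniformity _)
  have hG := hunif.differentiableOn hdiff hVo
  constructor
  · refine tendsto_comp_of_locally_uniform_limit
      (F := fun (p : ℕ × ℂ) (w : ℂ) =>
        deriv (fun w : ℂ => affine ((mapF (γ p.1) (δ p.1))^[m * q] (w : Sphere))) w)
      ((hG.deriv hVo).continuousOn.continuousAt (hVo.mem_nhds hζV)) tendsto_snd fun u hu => ?_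
    obtain ⟨t, ht, h3⟩ := (hunif.deriv hdiff hVo) u hu ζ hζV
    exact ⟨t, hVo.nhdsWithin_eq hζV ▸ ht, tendsto_fst.eventually h3⟩
  · refine eventually_prod_iff.2 ⟨_, hdiff, _, hVo.mem_nhds hζV, fun hk w hw => ?_⟩
    exact (hk w hw).differentiableAt (hVo.mem_nhds hw)

/-- Functions whose derivatives converge to a number other than `1` have at most one fixed point near
the limit point. -/
lemma eventually_eq_of_fixed {l : Filter ℕ} {f : ℕ → ℂ → ℂ} {ζ ρ : ℂ} (hρ : ρ ≠ 1)
    (hf : Tendsto (fun p : ℕ × ℂ => deriv (f p.1) p.2) (l ×ˢ 𝓝 ζ) (𝓝 ρ))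
    (hd : ∀ᶠ p : ℕ × ℂ in l ×ˢ 𝓝 ζ, DifferentiableAt ℂ (f p.1) p.2) {y y' : ℕ → ℂ}
    (hy : Tendsto y l (𝓝 ζ)) (hy' : Tendsto y' l (𝓝 ζ)) (hfy : ∀ k, f k (y k) = y k)
    (hfy' : ∀ k, f k (y' k) = y' k) : ∀ᶠ k in l, y k = y' k := by
  have hpos : 0 < ‖1 - ρ‖ := norm_pos_iff.2 (sub_ne_zero.2 hρ.symm)
  have h1 := hf.eventually (Metric.ball_mem_nhds ρ (half_pos hpos))
  obtain ⟨pa, hpa, pb, hpb, hp⟩ := eventually_prod_iff.1 (h1.and hd)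
  obtain ⟨r, hr, hball⟩ := Metric.mem_nhds_iff.1 hpb
  filter_upwards [hpa, hy.eventually (Metric.ball_mem_nhds ζ hr),
    hy'.eventually (Metric.ball_mem_nhds ζ hr)] with k hk hyk hyk'
  have h2 : ∀ w ∈ Metric.ball ζ r, HasDerivWithinAt (fun w => f k w - ρ * w)
      (deriv (f k) w - ρ) (Metric.ball ζ r) w := by
    intro w hw
    have h3 := (hp hk (hball hw)).2.hasDerivAt.sub ((hasDerivAt_id w).const_mul ρ)
    rw [mul_one] at h3
    exact h3.hasDerivWithinAt
  have h3 := (convex_ball ζ r).norm_image_sub_le_of_norm_hasDerivWithin_le h2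
    (fun w hw => (mem_ball_iff_norm.1 (hp hk (hball hw)).1).le) hyk' hyk
  rw [hfy, hfy', show y k - ρ * y k - (y' k - ρ * y' k) = (1 - ρ) * (y k - y' k) by ring,
    norm_mul] at h3
  by_contra hne
  have h4 : 0 < ‖y k - y' k‖ := norm_pos_iff.2 (sub_ne_zero.2 hne)
  nlinarith

lemma prod_range_shift {f : ℕ → ℂ} {n : ℕ} (hf : ∀ i, f (i + n) = f i) (j : ℕ) :
    ∏ i ∈ Finset.range n, f (j + i) = ∏ i ∈ Finset.range n, f i := by
  rcases n with _ | n
  · simp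
  induction j with
  | zero => simp
  | succ j ih =>
    rw [← ih, Finset.prod_range_succ, Finset.prod_range_succ', add_assoc j 1 n, add_comm 1 n, hf,
      add_zero]
    simp only [add_assoc, add_comm 1]

namespace LimitCycle

variable {l : Filter ℕ} {γ δ a b : ℕ → ℂ} {ω T : ℂ} {q n : ℕ} {x : ℕ → ℕ → ℂ} {L : ℕ → Sphere}

/-- The multiplier may be computed at any point of the cycle. -/
lemma deriv_eq (h : LimitCycle l γ δ a b ω T q n x L) (k j : ℕ) :
    deriv (fun w : ℂ => affine ((mapF (γ k) (δ k))^[n] (w : Sphere))) (x k j) =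
      ∏ i ∈ Finset.range n, γ k * (1 - x k i ^ 2) / (x k i ^ 2 + δ k * x k i + 1) ^ 2 := by
  have h1 := (h.orbit_shift k j n).hasSphereDeriv.hasDerivAt.deriv
  rw [add_zero] at h1
  rw [h1]
  refine prod_range_shift (f := fun i => γ k * (1 - x k i ^ 2) /
    (x k i ^ 2 + δ k * x k i + 1) ^ 2) (fun i => ?_) j
  simp only [h.periodic]

/-- A limiting cycle in `ℂ \ {0}` is a cycle of `G_T`. -/
lemma cycle_of_ne_zero [l.NeBot] (h : LimitCycle l γ δ a b ω T q n x L)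
    (h0 : ((0 : ℂ) : Sphere) ∉ Set.range L) (hinf : ∃ i, L i ≠ ∞) :
    ∃ j m : ℕ, ∃ ζ : ℂ, n = m * q ∧ L j = (ζ : Sphere) ∧ (mapG T)^[m] (ζ : Sphere) = ζ ∧
      (∀ i, (mapG T)^[i] (ζ : Sphere) ∈ ({((0 : ℂ) : Sphere), ∞} : Set Sphere)ᶜ) ∧
      (∀ i, L (j + i * q) = (mapG T)^[i] (ζ : Sphere)) ∧
      Set.range L = QuadraticLimit.orbit (mapG T) (ζ : Sphere) ∪ {∞} := by
  obtain ⟨j, hj⟩ := hinf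
  have hnz : ∀ i, L i ≠ ((0 : ℂ) : Sphere) := fun i hi => h0 ⟨i, hi⟩
  have hmem : ∀ i, L (j + i * q) ∈ ({((0 : ℂ) : Sphere), ∞} : Set Sphere)ᶜ := by
    intro i
    induction i with
    | zero => simpa using ⟨hnz j, hj⟩
    | succ i ih =>
      have h1 := mapG_ne_infty (T := T) ih
      rw [← h.step ih, add_assoc, ← Nat.succ_mul] at h1
      simpa using ⟨hnz _, h1⟩
  obtain ⟨ζ, hζ, hL⟩ := exists_coe_of_mem_compl (s := L j) (by simpa using ⟨hnz j, hj⟩)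
  have hG : ∀ i, L (j + i * q) = (mapG T)^[i] (ζ : Sphere) := by
    intro i
    rw [h.follow fun t _ => hmem t, hL]
  have hdvd : n % q = 0 := by
    by_contra hr
    have h1 := h.eq_infty (hmem (n / q)) (Nat.pos_of_ne_zero hr) (Nat.mod_lt _ h.q_pos)
    rw [add_assoc, Nat.div_add_mod', h.L_add_n] at h1
    exact hj h1
  have hn : n = n / q * q := by have := Nat.div_add_mod' n q; omega
  refine ⟨j, n / q, ζ, hn, hL, ?_, fun i => hG i ▸ hmem i, hG, ?_⟩
  · rw [← hG, ← hn, h.L_add_n, hL]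
  · apply Set.Subset.antisymm
    · rintro _ ⟨t, rfl⟩
      have h1 : t + j * n = j + (t + j * n - j) := by
        have := Nat.le_mul_of_pos_right j (show 0 < n by have := h.one_lt_n; omega)
        omega
      rw [← h.L_add_mul t j, h1]
      generalize t + j * n - j = s
      have h2 := Nat.div_add_mod' s q
      by_cases hr : s % q = 0
      · left
        rw [hr, add_zero] at h2
        exact ⟨s / q, by rw [← h2, hG, h2]⟩
      · right
        rw [← h2, ← add_assoc]
        exact h.eq_infty (hmem _) (Nat.pos_of_ne_zero hr) (Nat.mod_lt _ h.q_pos)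
    · rintro _ (⟨i, rfl⟩ | rfl)
      · exact ⟨_, hG i⟩
      · exact h.exists_eq_infty

/-- The period of a limiting cycle of `G_T` can drop only if two points of the approximating cycles
merge, which forces the limit multiplier to be `1`. -/
lemma multiplier_dichotomy [l.NeBot] (h : LimitCycle l γ δ a b ω T q n x L) {ρ : ℂ}
    (hρ : Tendsto (fun k => ∏ i ∈ Finset.range n,
      γ k * (1 - x k i ^ 2) / (x k i ^ 2 + δ k * x k i + 1) ^ 2) l (𝓝 ρ))
    {j m : ℕ} {ζ : ℂ} (hn : n = m * q) (hj : L j = (ζ : Sphere))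
    (hper : (mapG T)^[m] (ζ : Sphere) = ζ)
    (hmem : ∀ i, (mapG T)^[i] (ζ : Sphere) ∈ ({((0 : ℂ) : Sphere), ∞} : Set Sphere)ᶜ)
    (hG : ∀ i, L (j + i * q) = (mapG T)^[i] (ζ : Sphere)) :
    (Function.minimalPeriod (mapG T) (ζ : Sphere) = m ∧ eigenvalue (mapG T) m (ζ : Sphere) = ρ) ∨
      (ρ = 1 ∧ ∃ m' : ℕ, m' < m ∧ IsParabolic (mapG T) m' (ζ : Sphere)) := by
  obtain ⟨hderiv, hdiff⟩ := h.iterate.tendsto_deriv (m := m) fun i _ => hmem i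
  rw [← hn] at hderiv hdiff
  have hx : Tendsto (fun k => x k j) l (𝓝 ζ) := tendsto_coe_iff.1 (hj ▸ h.tendsto j)
  have heig : eigenvalue (mapG T) m (ζ : Sphere) = ρ := by
    refine tendsto_nhds_unique (hderiv.comp (tendsto_id.prodMk hx)) (hρ.congr fun k => ?_)
    exact (h.deriv_eq k j).symm
  have hmpos : 0 < m := by
    rcases Nat.eq_zero_or_pos m with rfl | hm
    · have := h.one_lt_n; omega
    · exact hm
  have hper' : Function.IsPeriodicPt (mapG T) m (ζ : Sphere) := hper
  have hpos := hper'.minimalPeriod_pos hmpos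
  obtain ⟨r, hr⟩ := hper'.minimalPeriod_dvd
  have hfix := Function.isPeriodicPt_minimalPeriod (mapG T) (ζ : Sphere)
  by_cases hr1 : Function.minimalPeriod (mapG T) (ζ : Sphere) = m
  · exact Or.inl ⟨hr1, heig⟩
  · right
    set m' := Function.minimalPeriod (mapG T) (ζ : Sphere) with hm'
    have hlt : m' < m := lt_of_le_of_ne (Nat.le_of_dvd hmpos ⟨r, hr⟩) hr1
    have hr0 : 0 < r := Nat.pos_of_ne_zero fun h0 => by simp [h0] at hr; omega
    have hρ1 : ρ = 1 := by
      by_contra hne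
      -- The points `x k j` and `x k (j + m' q)` of the cycle both converge to `ζ`.
      have hx' : Tendsto (fun k => x k (j + m' * q)) l (𝓝 ζ) := by
        refine tendsto_coe_iff.1 ?_
        have h1 := h.tendsto (j + m' * q)
        rwa [hG, hfix] at h1
      have hfp : ∀ i k, affine ((mapF (γ k) (δ k))^[n] (x k i : Sphere)) = x k i := by
        intro i k
        rw [h.map_iterate, h.periodic, affine_coe]
      have h2 := eventually_eq_of_fixed (l := l)
        (f := fun k w => affine ((mapF (γ k) (δ k))^[n] (w : Sphere)))
        hne (heig ▸ hderiv) hdiff hx hx' (hfp j) (hfp _)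
      obtain ⟨k, hk⟩ := h2.exists
      refine h.aperiodic k j (m' * q) (Nat.mul_pos hpos h.q_pos) ?_ hk.symm
      rw [hn]
      exact Nat.mul_lt_mul_of_pos_right hlt h.q_pos
    refine ⟨hρ1, m', hlt, hpos, rfl, ?_⟩
    -- The multiplier of the `m`-th iterate is the `r`-th power of that of the return map.
    obtain ⟨μ, hμ⟩ : ∃ μ, HasSphereDeriv (mapG T)^[m'] ζ ζ μ := by
      choose y hy0 hy using fun i => exists_coe_of_mem_compl (hmem i)
      have h1 : ∀ i < m', HasSphereDeriv (mapG T) (y i) (y (i + 1)) (1 - 1 / y i ^ 2) := by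
        intro i _
        have h2 := hy (i + 1)
        rw [Function.iterate_succ_apply', hy i, mapG_coe (hy0 i), coe_inj] at h2
        rw [← h2]
        exact hasSphereDeriv_mapG (hy0 i)
      have h3 := HasSphereDeriv.iterate h1
      have h4 : y 0 = ζ := coe_inj.1 (hy 0).symm
      have h5 : y m' = ζ := coe_inj.1 ((hy m').symm.trans hfix)
      rw [h4, h5] at h3
      exact ⟨_, h3⟩
    have hμr : μ ^ r = 1 := by
      have h1 := HasSphereDeriv.iterate (x := fun _ => ζ) (d := fun _ => μ) (N := r) fun _ _ => hμ
      rw [← Function.iterate_mul, ← hr, Finset.prod_const, Finset.card_range] at h1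
      rw [← h1.hasDerivAt.deriv, ← hρ1]
      exact heig
    have hμe : eigenvalue (mapG T) m' (ζ : Sphere) = μ := hμ.hasDerivAt.deriv
    have hord : 0 < orderOf μ := (isOfFinOrder_iff_pow_eq_one.2 ⟨r, hr0, hμr⟩).orderOf_pos
    refine ⟨orderOf μ, hord, hμe ▸ IsPrimitiveRoot.orderOf μ, fun hid => ?_⟩
    -- An iterate of `G_T` is not the identity since it sends `0` to `∞`.
    obtain ⟨t, ht⟩ := Nat.exists_eq_succ_of_ne_zero (Nat.mul_pos hpos hord).ne'
    have h1 := congrFun hid ((0 : ℂ) : Sphere)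
    rw [ht, Function.iterate_succ_apply, mapG_zero, mapG_iterate_infty] at h1
    exact OnePoint.infty_ne_coe _ h1

end LimitCycle

/-! ### The hypotheses of the theorem in affine terms -/

lemma FixedPointsMarked.sum_prod {γ δ a b : ℂ} (h : FixedPointsMarked γ δ a b) :
    a + b = -δ ∧ a * b = 1 - γ := by
  have h1 := h 1
  have h2 := h (-1)
  exact ⟨by linear_combination (h1 + h2) / 2, by linear_combination (h2 - h1) / 2⟩

lemma eigenvalue_fixed {γ δ a b : ℂ} (hγ : γ ≠ 0) (hs : a + b = -δ) (hp : a * b = 1 - γ) :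
    eigenvalue (mapF γ δ) 1 (a : Sphere) = (1 - a ^ 2) / γ := by
  have h1 : a ^ 2 + δ * a + 1 = γ := by linear_combination a * hs - hp
  have h2 := (hasSphereDeriv_mapF (γ := γ) (h1.symm ▸ hγ)).hasDerivAt.deriv
  have h3 : eigenvalue (mapF γ δ) 1 (a : Sphere) =
      deriv (fun w : ℂ => affine (mapF γ δ (w : Sphere))) a := rfl
  rw [h3, h2, h1]
  field_simp

lemma isAffineOrbit_of_minimalPeriod {γ δ : ℂ} {n : ℕ} (hn : 1 < n) {z : Sphere}
    (hz : Function.minimalPeriod (mapF γ δ) z = n) :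
    (∀ i, (mapF γ δ)^[i] z ≠ ∞) ∧
      ∀ N, IsAffineOrbit γ δ N (fun i => affine ((mapF γ δ)^[i] z)) := by
  have hper : Function.IsPeriodicPt (mapF γ δ) n z := hz ▸ Function.isPeriodicPt_minimalPeriod _ _
  have hfix : (mapF γ δ) ((0 : ℂ) : Sphere) = ((0 : ℂ) : Sphere) := mapF_zero γ δ
  have key : ∀ i, (mapF γ δ)^[i] z ≠ ((0 : ℂ) : Sphere) := by
    intro i h0
    have h1 : (mapF γ δ)^[i * n] z = z := by
      rw [mul_comm]; exact hper.mul_const i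
    have h2 : i ≤ i * n := Nat.le_mul_of_pos_right i (by omega)
    rw [← Nat.sub_add_cancel h2, Function.iterate_add_apply, h0, Function.iterate_fixed hfix] at h1
    rw [← h1, Function.minimalPeriod_eq_one_iff_isFixedPt.2 hfix] at hz
    omega
  have hmem : ∀ i, (mapF γ δ)^[i] z ∈ ({((0 : ℂ) : Sphere), ∞} : Set Sphere)ᶜ := by
    rintro i (h | h)
    · exact key i h
    · apply key (i + 1)
      rw [Function.iterate_succ_apply', h, mapF_infty]
  exact ⟨fun i h => hmem i (Or.inr h), fun N => (isAffineOrbit_of_iterate (hmem N)).2⟩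

end QuadraticLimit

theorem mainTheorem5
    (γ δ a b : ℕ → ℂ) (hγ0 : ∀ k, γ k ≠ 0)
    (hγ : Tendsto (fun k => ‖γ k‖) atTop atTop)
    (hfix : ∀ k, FixedPointsMarked (γ k) (δ k) (a k) (b k))
    (q : ℕ) (hq : 0 < q) (ω : ℂ) (hω : IsPrimitiveRoot ω q) (hω1 : ω ≠ 1)
    (hα : Tendsto (fun k => eigenvalue (mapF (γ k) (δ k)) 1 (a k : Sphere)) atTop (𝓝 ω))
    (T : ℂ)
    (hT : TendsToLocallyUniformlyOn (fun k => (mapF (γ k) (δ k))^[q]) (mapG T)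
      {((0 : ℂ) : Sphere), ∞}ᶜ)
    (n : ℕ) (hn : 1 < n) (z : ℕ → Sphere)
    (hz : ∀ k, Function.minimalPeriod (mapF (γ k) (δ k)) (z k) = n)
    (Z : Set Sphere) (hZ : SetsTendTo (fun k => orbit (mapF (γ k) (δ k)) (z k)) Z)
    (ρ : ℂ) (hρ : Tendsto (fun k => eigenvalue (mapF (γ k) (δ k)) n (z k)) atTop (𝓝 ρ)) :
    Tendsto (fun k => eigenvalue (mapF (γ k) (δ k)) 1 (b k : Sphere)) atTop
        (𝓝 ((starRingEnd ℂ) ω)) ∧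
    mapG T '' Z ⊆ Z ∧
    (Z = {∞} → T = 0) ∧
    (((0 : ℂ) : Sphere) ∈ Z →
      ∃ χ : ℂ, (χ = 1 ∨ χ = -1) ∧ ∃ m : ℕ, 1 ≤ m ∧ m * q < n ∧
        (mapG T)^[m] (χ : Sphere) = ((0 : ℂ) : Sphere) ∧
        (mapG T)^[m + 1] (χ : Sphere) = ∞ ∧
        (mapG T)^[m + 2] (χ : Sphere) = ∞) ∧
    (Z ≠ {∞} → ((0 : ℂ) : Sphere) ∉ Z →
      ∃ m : ℕ, n = m * q ∧
        ∃ ζ : ℂ, Z = orbit (mapG T) (ζ : Sphere) ∪ {∞} ∧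
          ∞ ∉ orbit (mapG T) (ζ : Sphere) ∧
          ((Function.minimalPeriod (mapG T) (ζ : Sphere) = m ∧
              eigenvalue (mapG T) m (ζ : Sphere) = ρ) ∨
            (ρ = 1 ∧ ∃ m' : ℕ, m' < m ∧ IsParabolic (mapG T) m' (ζ : Sphere)))) := by
  have hdeg : Degenerating atTop γ δ a b ω :=
    { ne_zero := hγ0
      sum := fun k => (hfix k).sum_prod.1
      prod := fun k => (hfix k).sum_prod.2
      inv_gamma := tendsto_zero_iff_norm_tendsto_zero.2
        (by simpa only [norm_inv, Function.comp_def] using tendsto_inv_atTop_zero.comp hγ)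
      mult := hα.congr fun k =>
        eigenvalue_fixed (hγ0 k) (hfix k).sum_prod.1 (hfix k).sum_prod.2
      omega_ne_zero := hω.ne_zero hq.ne' }
  -- The limit points of the cycles are taken along an ultrafilter, along which all orbits converge.
  let l : Ultrafilter ℕ := hyperfilter ℕ
  have hl : (l : Filter ℕ) ≤ atTop := by
    rw [← Nat.cofinite_eq_atTop]; exact hyperfilter_le_cofinite
  have hconv : ∀ y : ℕ → Sphere, ∃ s, Tendsto y l (𝓝 s) := fun y => by
    obtain ⟨s, -, hs⟩ := isCompact_univ.ultrafilter_le_nhds (l.map y) (by simp)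
    exact ⟨s, hs⟩
  choose L hL using fun i => hconv fun k => (mapF (γ k) (δ k))^[i] (z k)
  have horb := fun k => isAffineOrbit_of_minimalPeriod hn (hz k)
  have hper : ∀ k, Function.IsPeriodicPt (mapF (γ k) (δ k)) n (z k) := fun k =>
    hz k ▸ Function.isPeriodicPt_minimalPeriod _ _
  have hcoe : ∀ k i, (affine ((mapF (γ k) (δ k))^[i] (z k)) : Sphere) =
      (mapF (γ k) (δ k))^[i] (z k) := fun k i => coe_affine ((horb k).1 i)
  have hLC : LimitCycle l γ δ a b ω T q n
      (fun k i => affine ((mapF (γ k) (δ k))^[i] (z k))) L :=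
    { degenerating := hdeg.mono hl
      prim := hω
      omega_ne_one := hω1
      q_pos := hq
      one_lt_n := hn
      iterate := fun s hs =>
        (hT.tendsto_prod isOpen_compl_zero_infty hs (continuousAt_mapG hs)).mono_left
          (Filter.prod_mono_left _ hl)
      orbit := fun k => (horb k).2
      map_iterate := fun k i j => by
        rw [hcoe, hcoe, add_comm, Function.iterate_add_apply]
      periodic := fun k i => by
        rw [Function.iterate_add_apply, hper k]
      aperiodic := fun k i t ht htn heq => by
        have h1 := congrArg ((↑) : ℂ → Sphere) heq
        rw [hcoe, hcoe, add_comm, Function.iterate_add_apply] at h1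
        have h2 : Function.minimalPeriod (mapF (γ k) (δ k)) ((mapF (γ k) (δ k))^[i] (z k)) = n := by
          rw [Function.minimalPeriod_apply_iterate ⟨n, by omega, hper k⟩, hz]
        have h3 := Function.IsPeriodicPt.minimalPeriod_le ht h1
        omega
      tendsto := fun i => (hL i).congr fun k => (hcoe k i).symm }
  have hZeq : Z = Set.range L := by
    rw [← hLC.image_eq_range]
    refine hZ.eq_image hl (fun k => ?_) hL
    refine Set.Subset.antisymm ?_ ?_
    · rintro _ ⟨i, rfl⟩
      exact ⟨i % n, Nat.mod_lt _ (by omega), (hper k).iterate_mod_apply i⟩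
    · rintro _ ⟨i, -, rfl⟩
      exact ⟨i, rfl⟩
  have hprod : Tendsto (fun k => ∏ i ∈ Finset.range n,
      γ k * (1 - affine ((mapF (γ k) (δ k))^[i] (z k)) ^ 2) /
        (affine ((mapF (γ k) (δ k))^[i] (z k)) ^ 2 +
          δ k * affine ((mapF (γ k) (δ k))^[i] (z k)) + 1) ^ 2) l (𝓝 ρ) := by
    refine (hρ.mono_left hl).congr fun k => ?_
    have h1 : (affine (z k) : Sphere) = z k := hcoe k 0
    rw [← hLC.deriv_eq k 0]
    conv_lhs => rw [← h1]
    rfl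
  subst hZeq
  refine ⟨?_, hLC.mapsTo, ?_, ?_, ?_⟩
  · rw [← Complex.inv_eq_conj (hω.norm'_eq_one hq.ne')]
    refine hdeg.mult_b.congr fun k => (eigenvalue_fixed (b := a k) (hγ0 k) ?_ ?_).symm
    · rw [add_comm]; exact (hfix k).sum_prod.1
    · rw [mul_comm]; exact (hfix k).sum_prod.2
  · intro h
    exact hLC.translation_eq_zero fun i => by
      have h1 : L i ∈ Set.range L := ⟨i, rfl⟩
      rwa [h] at h1
  · intro h
    obtain ⟨χ, hχ, m, hm, hmn, h1⟩ := hLC.critical_orbit hprod h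
    refine ⟨χ, hχ, m, hm, hmn, h1, ?_, ?_⟩
    · rw [Function.iterate_succ_apply', h1, mapG_zero]
    · rw [Function.iterate_succ_apply', Function.iterate_succ_apply', h1, mapG_zero, mapG_infty]
  · intro h1 h0
    have hinf : ∃ i, L i ≠ ∞ := by
      by_contra! hall
      apply h1
      rw [show L = fun _ => ∞ from funext hall, Set.range_const]
    obtain ⟨j, m, ζ, hnm, hj, hζ, hmem, hG, hrange⟩ := hLC.cycle_of_ne_zero h0 hinf
    refine ⟨m, hnm, ζ, hrange, ?_, hLC.multiplier_dichotomy hprod hnm hj hζ hmem hG⟩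
    rintro ⟨i, hi⟩
    exact hmem i (Or.inr hi)
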